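/- Let $C/\mathbb{Q}$ be the smooth projective plane quartic $Y^3Z = X^4 - XZ^3$ (affine model $y^3 = x^4 - x$), which has good reduction at every prime $p \neq 3$. For a prime $p\neq 3$ let $$L_p(C,T) = (1-T)(1-pT)\exp\Big(\sum_{k\ge 1} |C(\mathbb{F}_{p^k})|\,\frac{T^k}{k}\Big), \qquad L(C,s) = \prod_{p\ne 3} L_p(C,p^{-s})^{-1}.$$ Let $K=\mathbb{Q}(\zeta)$, where $\zeta$ is a primitive $9$th root of unity, with ring of integers $\mathcal{O}$ and a fixed embedding $\iota\colon K\to\mathbb{C}$; let $\sigma_i\in\operatorname{Gal}(K/\mathbb{Q})$ be the automorphism with $\sigma_i(\zeta)=\zeta^i$, and put $\mathfrak{m} = (1+\zeta+\zeta^4)^4$. For an ideal $\mathfrak{n}$ of $\mathcal{O}$ let $I_K(\mathfrak{n})$ be the group of fractional ideals of $K$ coprime with $\mathfrak{n}$; a Grössencharakter modulo $\mathfrak{n}$ of infinity type $\{\sigma_1,\sigma_5,\sigma_7\}$ is a homomorphism $\psi\colon I_K(\mathfrak{n})\to\mathbb{C}^*$ with $$\psi(\alpha\mathcal{O}) = \iota\big(\sigma_1(\alpha)\,\sigma_5(\alpha)\,\sigma_7(\alpha)\big)\qquad\text{for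 all } \alpha\in K^*,\ \alpha\equiv 1 \ (\operatorname{mod}^*\mathfrak{n}),$$ and it has conductor $\mathfrak{n}$ if it does not extend to a Grössencharakter of this infinity type modulo a proper divisor of $\mathfrak{n}$. Let $\psi$ be the Grössencharakter of $K$ of conductor $\mathfrak{m}$ and infinity type $\{\sigma_1,\sigma_5,\sigma_7\}$, and let $$L(\psi,s)=\prod_{\mathfrak{p}\nmid\mathfrak{m}}\big(1-\psi(\mathfrak{p})\operatorname{N}(\mathfrak{p})^{-s}\big)^{-1},$$ the product over the nonzero prime ideals $\mathfrak{p}$ of $\mathcal{O}$ not dividing $\mathfrak{m}$. Then for every $s\in\mathbb{C}$ with $\operatorname{Re}(s)>3/2$ both Euler products converge absolutely and $$L(C,s)=L(\psi,s).$$ -/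

import Mathlib

open scoped NumberField nonZeroDivisors LinearAlgebra.Projectivization
open IsDedekindDomain

namespace PicardCM

noncomputable section

/-! ### The curve `C : y³ = x⁴ - x` and its `L`-function -/

/-- The number of points over the field `F` of the projective plane quartic
`Y³ Z = X⁴ - X Z³`, the projective closure of `y³ = x⁴ - x`.
(The equation is homogeneous, so the choice of representative does not matter.) -/
def pointCount (F : Type*) [Field F] : ℕ :=
  Nat.card {P : ℙ F (Fin 3 → F) //
    P.rep 1 ^ 3 * P.rep 2 = P.rep 0 ^ 4 - P.rep 0 * P.rep 2 ^ 3}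

/-- The zeta function of the curve over `𝔽_p` in the variable `T`:
`exp (∑_{k ≥ 1} |C(𝔽_{p^k})| T^k / k)`, a convergent series for `|T| < 1 / p`. -/
def zetaC (p : ℕ) [Fact p.Prime] (T : ℂ) : ℂ :=
  Complex.exp (∑' k : ℕ, (pointCount (GaloisField p (k + 1)) : ℂ) * T ^ (k + 1) / ((k : ℂ) + 1))

/-- The local factor `L_p(C, T) = (1 - T) (1 - p T) ζ(C/𝔽_p; T)`, for `|T| < 1 / p`. It is used
below only at `T = p^{-s}` with `Re s > 3/2`, where `|T| < 1 / p`. -/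
def localFactor (p : ℕ) [Fact p.Prime] (T : ℂ) : ℂ :=
  (1 - T) * (1 - p * T) * zetaC p T

/-- The primes of good reduction of the curve: all primes different from `3`. -/
abbrev GoodPrime : Type := {p : Nat.Primes // (p : ℕ) ≠ 3}

/-- The Euler factor `L_p(C, p^{-s})⁻¹` of `L(C, s)` at a prime `p` of good reduction. -/
def eulerFactorC (s : ℂ) (p : GoodPrime) : ℂ :=
  haveI : Fact ((p.1 : ℕ)).Prime := ⟨p.1.2⟩
  (localFactor (p.1 : ℕ) (((p.1 : ℕ) : ℂ) ^ (-s)))⁻¹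

/-- `L(C, s) = ∏_p L_p(C, p^{-s})⁻¹`, the product over the primes of good reduction. -/
def LC (s : ℂ) : ℂ := ∏' p : GoodPrime, eulerFactorC s p

/-! ### Grössencharaktere and their `L`-functions -/

section Hecke

variable {K : Type*} [Field K] [NumberField K]

/-- The group `I_K(𝔪)` of the fractional ideals of `K` that are coprime with `𝔪`: no prime divisor
of `𝔪` occurs in their factorization. -/
def coprimeIdeals (𝔪 : Ideal (𝓞 K)) : Subgroup (FractionalIdeal (𝓞 K)⁰ K)ˣ where
  carrier := {I | ∀ v : HeightOneSpectrum (𝓞 K), v.asIdeal ∣ 𝔪 →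
    FractionalIdeal.count K v (I : FractionalIdeal (𝓞 K)⁰ K) = 0}
  one_mem' := fun v _ => by
    simpa using FractionalIdeal.count_one K v
  mul_mem' := fun {I J} hI hJ v hv => by
    rw [Units.val_mul, FractionalIdeal.count_mul K v I.ne_zero J.ne_zero, hI v hv, hJ v hv,
      add_zero]
  inv_mem' := fun {I} hI v hv => by
    rw [Units.val_inv_eq_inv_val, FractionalIdeal.count_inv, hI v hv, neg_zero]

/-- `α ≡ 1 (mod^* 𝔪)`: `α = a / b` with integers `a ≡ b (mod 𝔪)` of `K` and `b` prime to `𝔪`.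
(`K` is totally complex in the application, so that there is no condition at infinity.) -/
def CongrOneMod (𝔪 : Ideal (𝓞 K)) (α : Kˣ) : Prop :=
  ∃ a b : 𝓞 K, IsCoprime (Ideal.span {b}) 𝔪 ∧ a - b ∈ 𝔪 ∧ (α : K) = (a : K) / (b : K)

/-- `ψ : I_K(𝔪) → ℂ^*` is a Grössencharakter modulo `𝔪` of infinity type `Φ`, a set of
automorphisms of `K`, where `K` is viewed in `ℂ` through `ι`:
`ψ(α𝓞) = ∏_{σ ∈ Φ} σ(α)` whenever `α ≡ 1 (mod^* 𝔪)`. -/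
def IsGrossencharakter (ι : K →+* ℂ) (Φ : Finset (K ≃ₐ[ℚ] K)) (𝔪 : Ideal (𝓞 K))
    (ψ : coprimeIdeals 𝔪 →* ℂˣ) : Prop :=
  ∀ (α : Kˣ) (I : coprimeIdeals 𝔪), CongrOneMod 𝔪 α →
    (I : (FractionalIdeal (𝓞 K)⁰ K)ˣ) = toPrincipalIdeal (𝓞 K) K α →
    (ψ I : ℂ) = ι (∏ σ ∈ Φ, σ (α : K))

/-- `ψ : I_K(𝔪) → ℂ^*` is a Grössencharakter of infinity type `Φ` and of conductor `𝔪`: it is one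
modulo `𝔪`, and it does not extend to a Grössencharakter modulo a proper divisor of `𝔪`. -/
def IsGrossencharakterOfConductor (ι : K →+* ℂ) (Φ : Finset (K ≃ₐ[ℚ] K)) (𝔪 : Ideal (𝓞 K))
    (ψ : coprimeIdeals 𝔪 →* ℂˣ) : Prop :=
  IsGrossencharakter ι Φ 𝔪 ψ ∧
    ∀ (𝔫 : Ideal (𝓞 K)) (ψ' : coprimeIdeals 𝔫 →* ℂˣ), 𝔫 ∣ 𝔪 → IsGrossencharakter ι Φ 𝔫 ψ' →
      (∀ (I : (FractionalIdeal (𝓞 K)⁰ K)ˣ) (h : I ∈ coprimeIdeals 𝔪) (h' : I ∈ coprimeIdeals 𝔫),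
        ψ' ⟨I, h'⟩ = ψ ⟨I, h⟩) →
      𝔫 = 𝔪

/-- A nonzero prime ideal as an invertible fractional ideal. -/
def primeUnit (P : HeightOneSpectrum (𝓞 K)) : (FractionalIdeal (𝓞 K)⁰ K)ˣ :=
  Units.mk0 (P.asIdeal : FractionalIdeal (𝓞 K)⁰ K)
    (FractionalIdeal.coeIdeal_ne_zero.mpr P.ne_bot)

/-- A prime not dividing `𝔪` lies in `I_K(𝔪)`. -/
theorem primeUnit_mem (𝔪 : Ideal (𝓞 K)) (P : HeightOneSpectrum (𝓞 K)) (hP : ¬ P.asIdeal ∣ 𝔪) :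
    primeUnit P ∈ coprimeIdeals 𝔪 := by
  intro v hv
  refine FractionalIdeal.count_maximal_coprime K v ?_
  rintro rfl
  exact hP hv

/-- The Euler factor `(1 - ψ(𝔭) N(𝔭)^{-s})⁻¹` of `L(ψ, s)` at a prime `𝔭` not dividing `𝔪`. -/
def eulerFactorPsi (𝔪 : Ideal (𝓞 K)) (ψ : coprimeIdeals 𝔪 →* ℂˣ) (s : ℂ)
    (P : {P : HeightOneSpectrum (𝓞 K) // ¬ P.asIdeal ∣ 𝔪}) : ℂ :=
  (1 - (ψ ⟨primeUnit P.1, primeUnit_mem 𝔪 P.1 P.2⟩ : ℂ) *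
    ((Ideal.absNorm P.1.asIdeal : ℕ) : ℂ) ^ (-s))⁻¹

/-- `L(ψ, s) = ∏_𝔭 (1 - ψ(𝔭) N(𝔭)^{-s})⁻¹`, the product over the primes not dividing `𝔪`. -/
def LPsi (𝔪 : Ideal (𝓞 K)) (ψ : coprimeIdeals 𝔪 →* ℂˣ) (s : ℂ) : ℂ :=
  ∏' P : {P : HeightOneSpectrum (𝓞 K) // ¬ P.asIdeal ∣ 𝔪}, eulerFactorPsi 𝔪 ψ s P

/-! ### The data for `K = ℚ(ζ)`, `ζ` a primitive ninth root of unity -/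

open Classical in
/-- `Φ^* = {σ₁, σ₅, σ₇}`, where `σ_i` is the automorphism of `K` with `σ_i ζ = ζ^i`. -/
def typeΦ (ζ : K) : Finset (K ≃ₐ[ℚ] K) :=
  {σ | σ ζ = ζ ^ 1 ∨ σ ζ = ζ ^ 5 ∨ σ ζ = ζ ^ 7}

/-- The ideal `𝔪 = (1 + ζ + ζ⁴)⁴` of the ring of integers. -/
def modulus {ζ : K} (hζ : IsPrimitiveRoot ζ 9) : Ideal (𝓞 K) :=
  Ideal.span {1 + hζ.toInteger + hζ.toInteger ^ 4} ^ 4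

end Hecke

end

end PicardCM

namespace PicardCM

/-! ### The Hasse–Davenport lifting relation for Jacobi sums -/

section HasseDavenport

open Polynomial Finset

variable (k : Type*) [Field k] [Finite k]

/-! Both Euler products are compared prime by prime. Write `λ = ζ - 1`, so that the modulus is
`(λ⁴)`, let `f` be the order of `p` modulo `9`, and let `q = p ^ f` be the norm of a prime `P` above
`p`.

Over a field whose order is not `1` modulo `9` the curve has as many points as the projective line.
Otherwise, for a character `χ` of order nine, the substitution `t = x³` turns the character sums
into six Jacobi sums `J(χ^i, χ^(3i))`, with `i` prime to `9`. By Hasse–Davenport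
(`jacobiSum_normLift`) the counts over `𝔽_{p^n}` with `f ∣ n` are `p^n + 1 - ∑ σ(β)^(n/f)`, where
`σ` runs over the Galois group and `β = -J(χ, χ³)` is formed on the residue field of `P`.

The ring of integers has class number one, and its units surject onto the units modulo `λ⁴`. Hence
`P = (π)` with `π ≡ 1` modulo `λ⁴`, and the infinity type forces `ψ(P) = ι(cmNorm π)`.

The crux is `exists_eq_gal_smul_cmNorm`: `β` is a Galois conjugate of `cmNorm π`. Three facts yield
this: the conjugates of `β` under `σ₁, σ₂, σ₄` lie in `P` (a piece of Stickelberger's theorem), `β`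
times its complex conjugate is `q`, and `β ≡ 1` modulo `λ⁴`. The first two, with invariance under
`σ_p`, fix the ideal of `β` up to conjugation and then `β` up to a root of unity; the congruence
removes the root of unity. Knowing `β` only up to conjugation is enough, as the count sums over all
conjugates.

Each prime above `p` occurs `f` times among the six conjugates of `P`, so exponentiating the zeta
series gives `∏ (1 - ψ(P) T^f)` over the primes above `p` (`localFactor_eq_prod`,
`eulerFactorC_eq_prod`). Since `|ψ(P)| = N(P)^(1/2)` and at most six primes lie above `p`,
everything converges absolutely for `Re s > 3/2` and the factors may be grouped. -/

theorem finite_setOf_monic_natDegree_eq (n : ℕ) :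
    {F : k[X] | F.Monic ∧ F.natDegree = n}.Finite := by
  refine Set.Finite.of_finite_image (f := fun F : k[X] => fun i : Fin (n + 1) => F.coeff i)
    (Set.toFinite _) ?_
  rintro F ⟨-, hF⟩ G ⟨-, hG⟩ h
  ext i
  by_cases hi : i < n + 1
  · exact congrFun h ⟨i, hi⟩
  · rw [coeff_eq_zero_of_natDegree_lt (by omega), coeff_eq_zero_of_natDegree_lt (by omega)]

/-- The monic polynomials of degree `n` over a finite field. -/
noncomputable def monicsOfDegree (n : ℕ) : Finset k[X] :=
  (finite_setOf_monic_natDegree_eq k n).toFinset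

variable {k}

@[simp]
theorem mem_monicsOfDegree {n : ℕ} {F : k[X]} :
    F ∈ monicsOfDegree k n ↔ F.Monic ∧ F.natDegree = n := by
  simp [monicsOfDegree]

variable (k) in
open Classical in
/-- The monic irreducible polynomials of degree at most `n` over a finite field. -/
noncomputable def monicIrreducibles (n : ℕ) : Finset k[X] :=
  ((range (n + 1)).biUnion (monicsOfDegree k)).filter Irreducible

@[simp]
theorem mem_monicIrreducibles {n : ℕ} {P : k[X]} :
    P ∈ monicIrreducibles k n ↔ P.Monic ∧ P.natDegree ≤ n ∧ Irreducible P := by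
  simp [monicIrreducibles]
  tauto

-- The exponent of `P` in `F` is the number of `j ≥ 1` with `P ^ j ∣ F`, so this is additivity of
-- the degree over the factorization. No exponent exceeds `d`, so cutting off at `d` loses nothing.
open Classical UniqueFactorizationMonoid in
theorem sum_natDegree_of_pow_dvd {d : ℕ} {F : k[X]} (hF : F.Monic) (hd : F.natDegree = d) :
    ∑ P ∈ monicIrreducibles k d, ∑ j ∈ Icc 1 d, (if P ^ j ∣ F then P.natDegree else 0) = d := by
  have hF0 := hF.ne_zero
  have hmon : ∀ P ∈ normalizedFactors F, P.Monic := fun P hP => by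
    have h := normalize_normalized_factor P hP
    rw [← h]
    exact monic_normalize (irreducible_of_normalized_factor P hP).ne_zero
  have hprod : (normalizedFactors F).prod = F := by
    have := prod_normalizedFactors_eq hF0
    rwa [hF.normalize_eq_self] at this
  have hdeg : ((normalizedFactors F).map natDegree).sum = d := by
    rw [← hd, ← natDegree_multiset_prod_of_monic _ hmon, hprod]
  rw [Finset.sum_multiset_map_count] at hdeg
  have hsub : (normalizedFactors F).toFinset ⊆ monicIrreducibles k d := by
    intro P hP
    rw [Multiset.mem_toFinset] at hP
    rw [mem_monicIrreducibles]
    exact ⟨hmon P hP, hd ▸ natDegree_le_of_dvd (dvd_of_mem_normalizedFactors hP) hF0,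
      irreducible_of_normalized_factor P hP⟩
  have hterm : ∀ P ∈ monicIrreducibles k d,
      ∑ j ∈ Icc 1 d, (if P ^ j ∣ F then P.natDegree else 0) =
        (normalizedFactors F).count P • P.natDegree := by
    intro P hP
    rw [mem_monicIrreducibles] at hP
    obtain ⟨hPm, hPd, hPi⟩ := hP
    have hiff : ∀ j, P ^ j ∣ F ↔ j ≤ (normalizedFactors F).count P := by
      intro j
      rw [dvd_iff_normalizedFactors_le_normalizedFactors (pow_ne_zero _ hPm.ne_zero) hF0,
        normalizedFactors_pow, normalizedFactors_irreducible hPi, hPm.normalize_eq_self,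
        Multiset.nsmul_singleton, ← Multiset.le_count_iff_replicate_le]
    have hcle : (normalizedFactors F).count P ≤ d := by
      have h1 := natDegree_le_of_dvd ((hiff _).2 le_rfl) hF0
      rw [natDegree_pow, hd] at h1
      exact (Nat.le_mul_of_pos_right _ hPi.natDegree_pos).trans h1
    rw [← Finset.sum_filter, Finset.sum_const]
    congr 1
    have : (Icc 1 d).filter (fun j => P ^ j ∣ F) = Icc 1 ((normalizedFactors F).count P) := by
      ext j
      simp only [mem_filter, mem_Icc, hiff]
      omega
    rw [this, Nat.card_Icc, Nat.add_sub_cancel]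
  rw [Finset.sum_congr rfl hterm]
  refine Eq.trans (Eq.symm ?_) hdeg
  refine Finset.sum_subset hsub fun P _ hP => ?_
  rw [Multiset.mem_toFinset, ← Multiset.count_eq_zero] at hP
  rw [hP, zero_smul]

/-! ### Multiplicative functions on monic polynomials and their Euler products -/

variable {R : Type*} [CommRing R]

/-- The sum of a multiplicative function over the monic polynomials of degree `n`. -/
noncomputable def monicSum (L : k[X] →* R) (n : ℕ) : R := ∑ F ∈ monicsOfDegree k n, L F

/-- The sum of `deg P · L(P)^j` over the powers `P ^ j` of degree `m` of monic irreducible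
polynomials. -/
noncomputable def primePowerSum (L : k[X] →* R) (m : ℕ) : R :=
  ∑ P ∈ monicIrreducibles k m,
    if P.natDegree ∣ m then (P.natDegree : R) * L P ^ (m / P.natDegree) else 0

open Classical in
theorem sum_pow_dvd (L : k[X] →* R) {P : k[X]} (hP : P.Monic) (d j : ℕ) :
    ∑ F ∈ monicsOfDegree k d, (if P ^ j ∣ F then L F else 0) =
      if j * P.natDegree ≤ d then L P ^ j * monicSum L (d - j * P.natDegree) else 0 := by
  rw [← Finset.sum_filter]
  have hPj : (P ^ j).Monic := hP.pow j
  split_ifs with h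
  · rw [monicSum, Finset.mul_sum]
    symm
    refine Finset.sum_bij (fun G _ => P ^ j * G) ?_ ?_ ?_ ?_
    · intro G hG
      rw [mem_monicsOfDegree] at hG
      rw [mem_filter, mem_monicsOfDegree]
      refine ⟨⟨hPj.mul hG.1, ?_⟩, dvd_mul_right _ _⟩
      rw [hPj.natDegree_mul hG.1, natDegree_pow, hG.2]
      omega
    · intro G _ G' _ hGG
      exact mul_left_cancel₀ hPj.ne_zero hGG
    · intro F hF
      rw [mem_filter, mem_monicsOfDegree] at hF
      obtain ⟨⟨hFm, hFd⟩, G, rfl⟩ := hF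
      have hG : G.Monic := hPj.of_mul_monic_left hFm
      refine ⟨G, ?_, rfl⟩
      rw [hPj.natDegree_mul hG, natDegree_pow] at hFd
      rw [mem_monicsOfDegree]
      exact ⟨hG, by omega⟩
    · intro G _
      rw [map_mul, map_pow]
  · refine Finset.sum_eq_zero fun F hF => absurd ?_ h
    rw [mem_filter, mem_monicsOfDegree] at hF
    rw [← hF.1.2, ← natDegree_pow]
    exact natDegree_le_of_dvd hF.2 hF.1.1.ne_zero

/-- The analogue of Newton's identities for the Euler product of a multiplicative function. -/
theorem natCast_mul_monicSum (L : k[X] →* R) (d : ℕ) :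
    (d : R) * monicSum L d = ∑ m ∈ Icc 1 d, primePowerSum L m * monicSum L (d - m) := by
  classical
  -- Write `d` as the weighted count of prime powers dividing each `F`, then sum over `F` first.
  have h1 : (d : R) * monicSum L d = ∑ P ∈ monicIrreducibles k d, ∑ j ∈ Icc 1 d,
      (P.natDegree : R) * ∑ F ∈ monicsOfDegree k d, (if P ^ j ∣ F then L F else 0) := by
    simp only [Finset.mul_sum]
    rw [monicSum, Finset.mul_sum]
    simp only [Finset.sum_comm (t := monicsOfDegree k d)]
    refine Finset.sum_congr rfl fun F hF => ?_
    rw [mem_monicsOfDegree] at hF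
    have h := congrArg (Nat.cast : ℕ → R) (sum_natDegree_of_pow_dvd hF.1 hF.2)
    rw [← h]
    push_cast
    simp only [Finset.sum_mul]
    refine Finset.sum_congr rfl fun P _ => Finset.sum_congr rfl fun j _ => ?_
    split_ifs <;> simp
  have h2 : ∀ m ∈ Icc 1 d, primePowerSum L m = ∑ P ∈ monicIrreducibles k d,
      if P.natDegree ∣ m then (P.natDegree : R) * L P ^ (m / P.natDegree) else 0 := by
    intro m hm
    rw [mem_Icc] at hm
    refine Finset.sum_subset ?_ ?_
    · intro P hP
      rw [mem_monicIrreducibles] at hP ⊢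
      exact ⟨hP.1, hP.2.1.trans hm.2, hP.2.2⟩
    · intro P hP hP'
      rw [mem_monicIrreducibles] at hP hP'
      rw [if_neg]
      intro hdvd
      exact hP' ⟨hP.1, Nat.le_of_dvd hm.1 hdvd, hP.2.2⟩
  have h3 : ∑ m ∈ Icc 1 d, primePowerSum L m * monicSum L (d - m) =
      ∑ P ∈ monicIrreducibles k d, ∑ m ∈ Icc 1 d, (if P.natDegree ∣ m then
        (P.natDegree : R) * L P ^ (m / P.natDegree) else 0) * monicSum L (d - m) := by
    rw [Finset.sum_comm]
    exact Finset.sum_congr rfl fun m hm => by rw [h2 m hm, Finset.sum_mul]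
  rw [h1, h3]
  refine Finset.sum_congr rfl fun P hP => ?_
  rw [mem_monicIrreducibles] at hP
  have hpos : 0 < P.natDegree := hP.2.2.natDegree_pos
  rw [Finset.sum_congr rfl fun j _ => by rw [sum_pow_dvd L hP.1]]
  simp only [mul_ite, mul_zero, ite_mul, zero_mul]
  rw [← Finset.sum_filter, ← Finset.sum_filter]
  -- Substitute `m = j · deg P`.
  refine Finset.sum_bij' (fun j _ => j * P.natDegree) (fun m _ => m / P.natDegree) ?_ ?_ ?_ ?_ ?_
  · intro j hj
    simp only [mem_filter, mem_Icc] at hj ⊢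
    exact ⟨⟨Nat.mul_pos hj.1.1 hpos, hj.2⟩, dvd_mul_left _ _⟩
  · intro m hm
    simp only [mem_filter, mem_Icc] at hm ⊢
    exact ⟨⟨Nat.div_pos (Nat.le_of_dvd hm.1.1 hm.2) hpos, (Nat.div_le_self _ _).trans hm.1.2⟩,
      (Nat.div_mul_le_self _ _).trans hm.1.2⟩
  · intro j _
    exact Nat.mul_div_cancel _ hpos
  · intro m hm
    simp only [mem_filter] at hm
    exact Nat.div_mul_cancel hm.2
  · intro j _
    rw [Nat.mul_div_cancel _ hpos, mul_assoc]

/-- The multiplicative function `F ↦ χ((-1)^{deg F} F(0)) ψ(F(1))` on polynomials. -/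
noncomputable def jacobiWeight (χ ψ : MulChar k R) : k[X] →* R where
  toFun F := χ ((-1) ^ F.natDegree * F.eval 0) * ψ (F.eval 1)
  map_one' := by simp
  map_mul' F G := by
    by_cases hF : F = 0
    · simp [hF, MulChar.map_zero]
    by_cases hG : G = 0
    · simp [hG, MulChar.map_zero]
    rw [natDegree_mul hF hG]
    simp only [eval_mul, map_mul, pow_add]
    ring

omit [Finite k] in
theorem jacobiWeight_apply (χ ψ : MulChar k R) (F : k[X]) :
    jacobiWeight χ ψ F = χ ((-1) ^ F.natDegree * F.eval 0) * ψ (F.eval 1) := rfl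

theorem monicSum_jacobiWeight_zero (χ ψ : MulChar k R) : monicSum (jacobiWeight χ ψ) 0 = 1 := by
  have : monicsOfDegree k 0 = {1} := by
    ext F
    rw [mem_monicsOfDegree, mem_singleton]
    exact ⟨fun h => h.1.natDegree_eq_zero.1 h.2, fun h => by simp [h]⟩
  rw [monicSum, this, sum_singleton, map_one]

theorem monicSum_jacobiWeight_one [Fintype k] (χ ψ : MulChar k R) :
    monicSum (jacobiWeight χ ψ) 1 = jacobiSum χ ψ := by
  rw [monicSum, jacobiSum]
  symm
  refine Finset.sum_bij (fun a _ => X - C a) ?_ ?_ ?_ ?_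
  · intro a _
    simp [monic_X_sub_C]
  · intro a _ b _ h
    simpa using h
  · intro F hF
    rw [mem_monicsOfDegree] at hF
    refine ⟨-F.coeff 0, mem_univ _, ?_⟩
    rw [C_neg, sub_neg_eq_add]
    exact (hF.1.eq_X_add_C hF.2).symm
  · intro a _
    simp [jacobiWeight_apply]

/-- In degree at least two, adding `cX` permutes the monic polynomials, keeps `F(0)` and moves
`F(1)` by `c`. Averaging over `c` leaves a complete sum of the nontrivial `ψ`. -/
theorem monicSum_jacobiWeight_eq_zero [IsDomain R] [CharZero R] (χ : MulChar k R)
    {ψ : MulChar k R} (hψ : ψ ≠ 1) {d : ℕ} (hd : 2 ≤ d) : monicSum (jacobiWeight χ ψ) d = 0 := by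
  classical
  have := Fintype.ofFinite k
  have hdeg : ∀ {F : k[X]} (c : k), F.Monic → F.natDegree = d →
      (C c * X).degree < F.degree := by
    intro F c hF hFd
    refine (degree_C_mul_X_le c).trans_lt ?_
    rw [degree_eq_natDegree hF.ne_zero, hFd]
    exact_mod_cast (by omega : 1 < d)
  have hmem : ∀ {F : k[X]} (c : k), F ∈ monicsOfDegree k d → F + C c * X ∈ monicsOfDegree k d := by
    intro F c hF
    rw [mem_monicsOfDegree] at hF ⊢
    refine ⟨hF.1.add_of_left (hdeg c hF.1 hF.2), ?_⟩
    rw [natDegree_add_eq_left_of_degree_lt (hdeg c hF.1 hF.2), hF.2]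
  have hshift : ∀ c : k, monicSum (jacobiWeight χ ψ) d =
      ∑ F ∈ monicsOfDegree k d, jacobiWeight χ ψ (F + C c * X) := by
    intro c
    rw [monicSum]
    symm
    refine Finset.sum_bij' (fun F _ => F + C c * X) (fun F _ => F + C (-c) * X)
      (fun F hF => hmem c hF) (fun F hF => hmem (-c) hF) ?_ ?_ (fun F _ => rfl)
    · intro F _
      rw [C_neg]
      ring
    · intro F _
      rw [C_neg]
      ring
  have hsum : (Fintype.card k : R) * monicSum (jacobiWeight χ ψ) d = 0 := by
    rw [← nsmul_eq_mul, ← Finset.card_univ, ← Finset.sum_const,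
      Finset.sum_congr rfl fun c _ => hshift c, Finset.sum_comm]
    refine Finset.sum_eq_zero fun F hF => ?_
    have hF' := hF
    rw [mem_monicsOfDegree] at hF'
    have hval : ∀ c : k, jacobiWeight χ ψ (F + C c * X) =
        χ ((-1) ^ d * F.eval 0) * ψ (F.eval 1 + c) := by
      intro c
      rw [jacobiWeight_apply, (mem_monicsOfDegree.1 (hmem c hF)).2]
      simp
    rw [Finset.sum_congr rfl fun c _ => hval c, ← Finset.mul_sum]
    have : ∑ c, ψ (F.eval 1 + c) = ∑ c, ψ c :=
      Equiv.sum_comp (Equiv.addLeft (F.eval 1)) (fun c => ψ c)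
    rw [this, MulChar.sum_eq_zero_of_ne_one hψ, mul_zero]
  exact (mul_eq_zero.1 hsum).resolve_left (Nat.cast_ne_zero.2 Fintype.card_ne_zero)

/-- The generating series of `monicSum` is `1 + J T`, so the prime power sums are power sums of a
single root `-J`; Newton's identity becomes a two-term recursion. -/
theorem primePowerSum_jacobiWeight [IsDomain R] [CharZero R] [Fintype k] (χ : MulChar k R)
    {ψ : MulChar k R} (hψ : ψ ≠ 1) (m : ℕ) :
    primePowerSum (jacobiWeight χ ψ) (m + 1) = -(-jacobiSum χ ψ) ^ (m + 1) := by
  induction m with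
  | zero =>
    have h := natCast_mul_monicSum (jacobiWeight χ ψ) 1
    simp only [Nat.cast_one, one_mul, Icc_self, sum_singleton, Nat.sub_self,
      monicSum_jacobiWeight_zero, mul_one] at h
    simp [← h, monicSum_jacobiWeight_one]
  | succ m ih =>
    have h := natCast_mul_monicSum (jacobiWeight χ ψ) (m + 2)
    rw [monicSum_jacobiWeight_eq_zero χ hψ (by omega), mul_zero,
      Finset.sum_Icc_succ_top (by omega), Finset.sum_Icc_succ_top (by omega),
      Finset.sum_eq_zero (s := Icc 1 m)] at h
    · rw [show m + 2 - (m + 1) = 1 by omega, show m + 1 + 1 - (m + 2) = 0 by omega,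
        monicSum_jacobiWeight_one, monicSum_jacobiWeight_zero, ih] at h
      rw [pow_succ]
      linear_combination -h
    · intro i hi
      rw [mem_Icc] at hi
      rw [monicSum_jacobiWeight_eq_zero χ hψ (by omega), mul_zero]

/-! ### Elements of an extension, their minimal polynomials and norms -/

variable (F : Type*) [Field F] [Finite F] [Algebra k F]

-- The roots of `P` in `F` correspond to the `k`-embeddings of `k[X]/(P)` into `F`, and these are
-- counted by Galois theory of finite fields.
omit [Finite k] in
theorem card_minpoly_eq [Fintype F] [DecidableEq k[X]] {P : k[X]} (hP : P.Monic)
    (hPi : Irreducible P) :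
    (univ.filter fun x : F => minpoly k x = P).card =
      if P.natDegree ∣ Module.finrank k F then P.natDegree else 0 := by
  classical
  split_ifs with h
  · have := Fact.mk hPi
    have : Module.Finite k (AdjoinRoot P) := hP.finite_adjoinRoot
    have hfin : Module.finrank k (AdjoinRoot P) = P.natDegree := by
      rw [(AdjoinRoot.powerBasis hP.ne_zero).finrank, AdjoinRoot.powerBasis_dim]
    have h1 := FiniteField.natCard_algHom_of_finrank_dvd (F := k) (K := AdjoinRoot P) (L := F)
      (by rwa [hfin])
    rw [hfin] at h1
    rw [← h1, Nat.card_congr (AdjoinRoot.equiv F k P hP.ne_zero), Nat.card_eq_fintype_card,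
      Fintype.card_subtype]
    congr 1
    ext x
    rw [mem_filter, mem_filter, mem_aroots]
    simp only [mem_univ, true_and, hP.ne_zero, ne_eq, not_false_eq_true]
    exact ⟨fun hx => hx ▸ minpoly.aeval k x,
      fun hx => (minpoly.eq_of_irreducible_of_monic hPi hx hP).symm⟩
  · rw [Finset.card_eq_zero, Finset.filter_eq_empty_iff]
    rintro x - rfl
    exact h (minpoly.degree_dvd (Algebra.IsIntegral.isIntegral x))

omit [Finite k] in
theorem norm_eq_minpoly_eval_zero (x : F) :
    Algebra.norm k x = ((-1) ^ (minpoly k x).natDegree * (minpoly k x).eval 0) ^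
      (Module.finrank k F / (minpoly k x).natDegree) := by
  have hx : IsIntegral k x := Algebra.IsIntegral.isIntegral x
  have hgen := Algebra.PowerBasis.norm_gen_eq_coeff_zero_minpoly
    (IntermediateField.adjoin.powerBasis hx)
  rw [IntermediateField.adjoin.powerBasis_gen, IntermediateField.minpoly_gen,
    IntermediateField.adjoin.powerBasis_dim, coeff_zero_eq_eval_zero] at hgen
  rw [Algebra.norm_eq_norm_adjoin, hgen]
  congr 1
  rw [← Module.finrank_mul_finrank k (IntermediateField.adjoin k {x}) F,
    IntermediateField.adjoin.finrank hx, Nat.mul_div_cancel_left _ (minpoly.natDegree_pos hx)]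

omit [Finite k] in
theorem norm_one_sub_eq_minpoly_eval_one (x : F) :
    Algebra.norm k (1 - x) = (minpoly k x).eval 1 ^
      (Module.finrank k F / (minpoly k x).natDegree) := by
  have hx : IsIntegral k x := Algebra.IsIntegral.isIntegral x
  have hmin : minpoly k (1 - x) = (-1) ^ (minpoly k x).natDegree *
      ((minpoly k x).comp (X + C 1)).comp (-X) := by
    have := minpoly.sub_algebraMap x (1 : k)
    rw [map_one] at this
    rw [← neg_sub, minpoly.neg, this, natDegree_comp, natDegree_X_add_C, mul_one]
  have hdeg : (minpoly k (1 - x)).natDegree = (minpoly k x).natDegree := by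
    have h : ∀ n : ℕ, ((-1 : k[X]) ^ n) = C ((-1) ^ n) := fun n => by simp
    rw [hmin, h, natDegree_C_mul (by simp), natDegree_comp, natDegree_comp, natDegree_neg,
      natDegree_X_add_C, natDegree_X, mul_one, mul_one]
  rw [norm_eq_minpoly_eval_zero, hdeg, hmin]
  congr 1
  simp [← mul_assoc, ← mul_pow]

variable {F} in
omit [Finite k] in
theorem mulChar_norm_mul_norm (χ ψ : MulChar k R) (x : F) :
    χ (Algebra.norm k x) * ψ (Algebra.norm k (1 - x)) =
      jacobiWeight χ ψ (minpoly k x) ^ (Module.finrank k F / (minpoly k x).natDegree) := by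
  rw [norm_eq_minpoly_eval_zero, norm_one_sub_eq_minpoly_eval_one, map_pow, map_pow, ← mul_pow,
    jacobiWeight_apply]

/-- **Hasse–Davenport relation** for Jacobi sums, in terms of norms. -/
theorem sum_mulChar_norm [IsDomain R] [CharZero R] [Fintype k] [Fintype F] (χ : MulChar k R)
    {ψ : MulChar k R} (hψ : ψ ≠ 1) :
    ∑ x : F, χ (Algebra.norm k x) * ψ (Algebra.norm k (1 - x)) =
      -(-jacobiSum χ ψ) ^ Module.finrank k F := by
  classical
  obtain ⟨m, hm⟩ : ∃ m, Module.finrank k F = m + 1 :=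
    Nat.exists_eq_succ_of_ne_zero Module.finrank_pos.ne'
  rw [hm, ← primePowerSum_jacobiWeight χ hψ m, ← hm, primePowerSum]
  have hmaps : ∀ x ∈ (univ : Finset F), minpoly k x ∈ monicIrreducibles k (Module.finrank k F) := by
    intro x _
    have hx : IsIntegral k x := Algebra.IsIntegral.isIntegral x
    exact mem_monicIrreducibles.2 ⟨minpoly.monic hx,
      Nat.le_of_dvd Module.finrank_pos (minpoly.degree_dvd hx), minpoly.irreducible hx⟩
  -- Grouped by minimal polynomial, the sum over `F` is exactly `primePowerSum`.
  rw [← Finset.sum_fiberwise_of_maps_to hmaps]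
  refine Finset.sum_congr rfl fun P hP => ?_
  rw [mem_monicIrreducibles] at hP
  have : ∀ x ∈ univ.filter (fun x : F => minpoly k x = P),
      χ (Algebra.norm k x) * ψ (Algebra.norm k (1 - x)) =
        jacobiWeight χ ψ P ^ (Module.finrank k F / P.natDegree) := by
    intro x hx
    rw [mem_filter] at hx
    rw [mulChar_norm_mul_norm, hx.2]
  rw [Finset.sum_congr rfl this, Finset.sum_const, card_minpoly_eq F hP.1 hP.2.2, nsmul_eq_mul]
  split_ifs <;> simp

/-- The lift of a multiplicative character along the norm of an extension of finite fields. -/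
noncomputable def normLift (χ : MulChar k R) : MulChar F R where
  toMonoidHom := χ.toMonoidHom.comp (Algebra.norm k)
  map_nonunit' x hx := by
    rw [isUnit_iff_ne_zero, not_not] at hx
    change χ (Algebra.norm k x) = 0
    rw [hx, Algebra.norm_zero, MulChar.map_zero]

omit [Finite k] in
theorem normLift_apply (χ : MulChar k R) (x : F) : normLift F χ x = χ (Algebra.norm k x) := rfl

omit [Finite k] in
theorem normLift_pow (χ : MulChar k R) (n : ℕ) : normLift F (χ ^ n) = normLift F χ ^ n := by
  ext x
  have hx : IsUnit (Algebra.norm k (x : F)) := x.isUnit.map _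
  rw [MulChar.pow_apply_coe, normLift_apply, normLift_apply, ← hx.unit_spec, MulChar.pow_apply_coe]

omit [Finite k] in
theorem normLift_eq_one_iff (χ : MulChar k R) : normLift F χ = 1 ↔ χ = 1 := by
  refine ⟨fun h => ?_, fun h => ?_⟩
  · ext a
    obtain ⟨x, hx⟩ := FiniteField.norm_surjective k F (a : k)
    have hx0 : IsUnit x := isUnit_iff_ne_zero.2 fun h0 => a.ne_zero (by simp [← hx, h0])
    rw [MulChar.one_apply_coe, ← hx, ← normLift_apply, h, MulChar.one_apply hx0]
  · ext x
    have hx : IsUnit (Algebra.norm k (x : F)) := x.isUnit.map _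
    rw [normLift_apply, h, MulChar.one_apply hx, MulChar.one_apply_coe]

omit [Finite k] in
theorem orderOf_normLift (χ : MulChar k R) : orderOf (normLift F χ) = orderOf χ :=
  orderOf_eq_orderOf_iff.2 fun n => by rw [← normLift_pow, normLift_eq_one_iff]

/-- **Hasse–Davenport relation** for Jacobi sums. -/
theorem jacobiSum_normLift [IsDomain R] [CharZero R] [Fintype k] [Fintype F] (χ : MulChar k R)
    {ψ : MulChar k R} (hψ : ψ ≠ 1) :
    jacobiSum (normLift F χ) (normLift F ψ) = -(-jacobiSum χ ψ) ^ Module.finrank k F :=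
  sum_mulChar_norm F χ hψ

end HasseDavenport

end PicardCM

namespace PicardCM

/-! ### Counting the points of the curve over finite fields -/

section PointCount

open Finset

/-- The affine points of `y³ = x⁴ - x`. -/
abbrev AffinePoint (F : Type*) [Field F] : Type _ := {v : F × F // v.2 ^ 3 = v.1 ^ 4 - v.1}

theorem rep_equation_iff {F : Type*} [Field F] (v : Fin 3 → F) (hv : v ≠ 0) :
    ((Projectivization.mk F v hv).rep 1 ^ 3 * (Projectivization.mk F v hv).rep 2 =
      (Projectivization.mk F v hv).rep 0 ^ 4 -
        (Projectivization.mk F v hv).rep 0 * (Projectivization.mk F v hv).rep 2 ^ 3) ↔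
      v 1 ^ 3 * v 2 = v 0 ^ 4 - v 0 * v 2 ^ 3 := by
  obtain ⟨a, ha⟩ := Projectivization.exists_smul_eq_mk_rep F v hv
  rw [← ha]
  simp only [Pi.smul_apply, Units.smul_def, smul_eq_mul]
  have h4 : (a : F) ^ 4 ≠ 0 := pow_ne_zero _ a.ne_zero
  constructor
  · intro h
    refine mul_left_cancel₀ h4 ?_
    linear_combination h
  · intro h
    linear_combination (a : F) ^ 4 * h

/-- Putting `Z = 0` in the equation forces `X = 0`, so `[0 : 1 : 0]` is the only point at infinity.
-/
theorem pointCount_eq (F : Type*) [Field F] [Finite F] :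
    pointCount F = Nat.card (AffinePoint F) + 1 := by
  classical
  have hv0 : ∀ v : F × F, (![v.1, v.2, 1] : Fin 3 → F) ≠ 0 := fun v h => by
    simpa using congrFun h 2
  have hi0 : (![0, 1, 0] : Fin 3 → F) ≠ 0 := fun h => by simpa using congrFun h 1
  let f : Option (AffinePoint F) → {P : ℙ F (Fin 3 → F) //
      P.rep 1 ^ 3 * P.rep 2 = P.rep 0 ^ 4 - P.rep 0 * P.rep 2 ^ 3} := fun o =>
    match o with
    | none => ⟨.mk F _ hi0, (rep_equation_iff _ hi0).2 (by simp)⟩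
    | some v => ⟨.mk F _ (hv0 v.1), (rep_equation_iff _ (hv0 v.1)).2 (by simpa using v.2)⟩
  have hf : Function.Bijective f := by
    constructor
    · rintro (_ | ⟨v, hv⟩) (_ | ⟨w, hw⟩) h
      · rfl
      · obtain ⟨a, ha⟩ := (Projectivization.mk_eq_mk_iff' F _ _ hi0 (hv0 w)).1
          (congrArg Subtype.val h)
        have h1 := congrFun ha 1
        have h2 := congrFun ha 2
        simp only [Pi.smul_apply, smul_eq_mul, Matrix.cons_val] at h1 h2
        simp_all
      · obtain ⟨a, ha⟩ := (Projectivization.mk_eq_mk_iff' F _ _ (hv0 v) hi0).1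
          (congrArg Subtype.val h)
        have h2 := congrFun ha 2
        simp at h2
      · obtain ⟨a, ha⟩ := (Projectivization.mk_eq_mk_iff' F _ _ (hv0 v) (hv0 w)).1
          (congrArg Subtype.val h)
        have h0 := congrFun ha 0
        have h1 := congrFun ha 1
        have h2 := congrFun ha 2
        simp only [Pi.smul_apply, smul_eq_mul, Matrix.cons_val, mul_one] at h0 h1 h2
        subst h2
        rw [one_mul] at h0 h1
        have : v = w := Prod.ext h0.symm h1.symm
        subst this
        rfl
    · rintro ⟨P, hP⟩
      induction P using Projectivization.ind with
      | h v hv =>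
        have hP' := (rep_equation_iff v hv).1 hP
        by_cases h2 : v 2 = 0
        · have h0 : v 0 = 0 := by
            rw [h2] at hP'
            have : v 0 ^ 4 = 0 := by linear_combination -hP'
            exact pow_eq_zero_iff (by norm_num) |>.1 this
          refine ⟨none, Subtype.ext ?_⟩
          refine (Projectivization.mk_eq_mk_iff' F _ _ hi0 hv).2 ⟨(v 1)⁻¹, ?_⟩
          have h1 : v 1 ≠ 0 := by
            intro h1
            exact hv (funext fun i => by fin_cases i <;> simp [h0, h1, h2])
          funext i
          fin_cases i <;> simp [h0, h1, h2]
        · refine ⟨some ⟨(v 0 / v 2, v 1 / v 2), ?_⟩, Subtype.ext ?_⟩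
          · field_simp
            linear_combination hP'
          · refine (Projectivization.mk_eq_mk_iff' F _ _ (hv0 _) hv).2 ⟨(v 2)⁻¹, ?_⟩
            funext i
            fin_cases i <;> simp [h2, div_eq_inv_mul]
  rw [pointCount, ← Nat.card_congr (Equiv.ofBijective f hf), Finite.card_option]

/-! ### Affine points as character sums and Jacobi sums -/

variable {F : Type*} [Field F] [Fintype F] [DecidableEq F]

omit [DecidableEq F] in
theorem exists_isPrimitiveRoot_of_dvd_card_sub_one {n : ℕ} (h : n ∣ Fintype.card F - 1) :
    ∃ ω : F, IsPrimitiveRoot ω n := by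
  classical
  obtain ⟨g, hg⟩ := IsCyclic.exists_ofOrder_eq_natCard (α := Fˣ)
  obtain ⟨c, hc⟩ := h
  refine ⟨(g : F) ^ c, (IsPrimitiveRoot.coe_units_iff.2 (IsPrimitiveRoot.orderOf g)).pow
    (orderOf_pos g) ?_⟩
  rw [hg, Nat.card_eq_fintype_card, Fintype.card_units, hc, mul_comm]

theorem card_affinePoint :
    Nat.card (AffinePoint F) = ∑ x : F, (univ.filter fun y : F => y ^ 3 = x ^ 4 - x).card := by
  rw [Nat.card_eq_fintype_card, Fintype.card_subtype, Finset.card_filter,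
    Fintype.sum_prod_type]
  exact Finset.sum_congr rfl fun x _ => (Finset.card_filter _ _).symm

/-- Cubing is a bijection of `F`, so every `x` has exactly one `y`. -/
theorem card_affinePoint_of_not_three_dvd (h : ¬ 3 ∣ Fintype.card F - 1) :
    Nat.card (AffinePoint F) = Fintype.card F := by
  have hinj : Function.Injective fun y : F => y ^ 3 := by
    intro y z hyz
    by_cases hz : z = 0
    · simpa [hz] using hyz
    · have h1 : (y / z) ^ 3 = 1 := by
        rw [div_pow, div_eq_one_iff_eq (pow_ne_zero _ hz)]
        exact hyz
      have h2 : (y / z) ^ (Fintype.card F - 1) = 1 := by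
        refine FiniteField.pow_card_sub_one_eq_one _ fun h0 => ?_
        simp [h0] at h1
      have h3 : Nat.Coprime 3 (Fintype.card F - 1) :=
        (Nat.Prime.coprime_iff_not_dvd (by norm_num)).2 h
      have h4 := (pow_gcd_eq_one (a := y / z)).2 ⟨h1, h2⟩
      rw [h3, pow_one, div_eq_one_iff_eq hz] at h4
      exact h4
  have hbij := Finite.injective_iff_bijective.1 hinj
  rw [card_affinePoint]
  have : ∀ x : F, (univ.filter fun y : F => y ^ 3 = x ^ 4 - x).card = 1 := by
    intro x
    obtain ⟨y, hy, huniq⟩ := hbij.existsUnique (x ^ 4 - x)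
    rw [Finset.card_eq_one]
    refine ⟨y, ?_⟩
    ext z
    simp only [mem_filter, mem_univ, true_and, mem_singleton]
    exact ⟨fun hz => huniq z hz, fun hz => hz ▸ hy⟩
  simp [this]

variable {R : Type*} [CommRing R] [IsDomain R]

omit [DecidableEq F] in
/-- For a character of order `n`, the kernel consists of the `n`-th powers. -/
theorem exists_pow_eq_of_mulChar_eq_one (η : MulChar F R) {a : F} (ha : η a = 1) :
    ∃ b : F, b ^ orderOf η = a := by
  classical
  obtain ⟨g, hg⟩ := IsCyclic.exists_generator (α := Fˣ)
  have ha0 : a ≠ 0 := fun h => by simp [h, MulChar.map_zero] at ha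
  obtain ⟨n, hn⟩ := (mem_powers_iff_mem_zpowers).2 (hg (Units.mk0 a ha0))
  have hn' : (g : F) ^ n = a := by
    have := congrArg Units.val hn
    simpa using this
  have h1 : η ^ n = 1 := by
    rw [MulChar.eq_iff hg, MulChar.pow_apply_coe, MulChar.one_apply_coe, ← map_pow, hn', ha]
  obtain ⟨c, rfl⟩ := orderOf_dvd_of_pow_eq_one h1
  exact ⟨(g : F) ^ c, by rw [← pow_mul, mul_comm, hn']⟩

theorem card_cube_roots {η : MulChar F R} (hη : orderOf η = 3) (a : F) :
    ((univ.filter fun y : F => y ^ 3 = a).card : R) = 1 + η a + (η ^ 2) a := by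
  have h3 : 3 ∣ Fintype.card F - 1 := hη ▸ MulChar.orderOf_dvd_card_sub_one F η
  rw [MulChar.pow_apply' _ two_ne_zero]
  by_cases ha : a = 0
  · have : (univ.filter fun y : F => y ^ 3 = a) = {0} := by
      ext y
      simp [ha]
    rw [this]
    simp [ha, MulChar.map_zero]
  · by_cases hc : ∃ b, b ^ 3 = a
    · obtain ⟨ω, hω⟩ := exists_isPrimitiveRoot_of_dvd_card_sub_one h3
      have hset : (univ.filter fun y : F => y ^ 3 = a) = (Polynomial.nthRoots 3 a).toFinset := by
        ext y
        simp [Polynomial.mem_nthRoots]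
      rw [hset, Multiset.toFinset_card_of_nodup (hω.nthRoots_nodup ha), hω.card_nthRoots, if_pos hc]
      obtain ⟨b, rfl⟩ := hc
      have hb : IsUnit b := isUnit_iff_ne_zero.2 fun h0 => ha (by simp [h0])
      have : η (b ^ 3) = 1 := by
        rw [map_pow, ← MulChar.pow_apply' _ (by norm_num), ← hη, pow_orderOf_eq_one,
          MulChar.one_apply hb]
      rw [this]
      norm_num
    · have hset : (univ.filter fun y : F => y ^ 3 = a) = ∅ := by
        rw [Finset.filter_eq_empty_iff]
        exact fun y _ hy => hc ⟨y, hy⟩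
      have h1 : η a ≠ 1 := fun h => hc (hη ▸ exists_pow_eq_of_mulChar_eq_one η h)
      have h2 : η a ^ 3 = 1 := by
        rw [← MulChar.pow_apply' _ (by norm_num), ← hη, pow_orderOf_eq_one,
          MulChar.one_apply (isUnit_iff_ne_zero.2 ha)]
      rw [hset, card_empty, Nat.cast_zero]
      refine mul_left_cancel₀ (sub_ne_zero.2 h1) ?_
      linear_combination -h2

theorem natCast_card_affinePoint {η : MulChar F R} (hη : orderOf η = 3) :
    (Nat.card (AffinePoint F) : R) =
      Fintype.card F + ∑ x, η (x ^ 4 - x) + ∑ x, (η ^ 2) (x ^ 4 - x) := by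
  rw [card_affinePoint, Nat.cast_sum, Finset.sum_congr rfl fun x _ => card_cube_roots hη _,
    Finset.sum_add_distrib, Finset.sum_add_distrib]
  simp

-- Replacing `x` by `ωx`, with `ω` a primitive cube root of unity, multiplies `x⁴ - x` by `ω`. Here
-- `η ω ≠ 1`: otherwise `ω` would be a cube and `F` would contain an element of order nine.
omit [DecidableEq F] in
theorem sum_mulChar_eq_zero_of_not_nine_dvd {η : MulChar F R} (hη : orderOf η = 3)
    (h9 : ¬ 9 ∣ Fintype.card F - 1) : ∑ x, η (x ^ 4 - x) = 0 := by
  have h3 : 3 ∣ Fintype.card F - 1 := hη ▸ MulChar.orderOf_dvd_card_sub_one F η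
  obtain ⟨ω, hω⟩ := exists_isPrimitiveRoot_of_dvd_card_sub_one h3
  have hω0 : ω ≠ 0 := hω.ne_zero (by norm_num)
  have hne : η ω ≠ 1 := by
    intro h
    obtain ⟨b, hb⟩ := exists_pow_eq_of_mulChar_eq_one η h
    rw [hη] at hb
    refine h9 ?_
    have hb0 : b ≠ 0 := fun h0 => hω0 (by rw [← hb, h0]; norm_num)
    have hb9 : orderOf b = 3 ^ (1 + 1) := by
      refine orderOf_eq_prime_pow (p := 3) ?_ ?_
      · rw [pow_one, hb]
        exact hω.ne_one (by norm_num)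
      · rw [pow_succ, pow_one, pow_mul, hb, hω.pow_eq_one]
    have := orderOf_dvd_of_pow_eq_one (FiniteField.pow_card_sub_one_eq_one b hb0)
    rw [hb9] at this
    exact this
  have hscale : ∑ x, η (x ^ 4 - x) = η ω * ∑ x, η (x ^ 4 - x) := by
    rw [Finset.mul_sum, ← Equiv.sum_comp (Equiv.mulLeft₀ ω hω0)]
    refine Finset.sum_congr rfl fun x _ => ?_
    rw [← map_mul]
    congr 1
    rw [Equiv.mulLeft₀_apply]
    linear_combination ω * x ^ 4 * hω.pow_eq_one
  have h0 : (η ω - 1) * ∑ x, η (x ^ 4 - x) = 0 := by linear_combination -hscale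
  exact (mul_eq_zero.1 h0).resolve_left (sub_ne_zero.2 hne)

theorem card_affinePoint_of_not_nine_dvd (h9 : ¬ 9 ∣ Fintype.card F - 1) :
    Nat.card (AffinePoint F) = Fintype.card F := by
  by_cases h3 : 3 ∣ Fintype.card F - 1
  · obtain ⟨η, hη⟩ := MulChar.exists_mulChar_orderOf F h3
      (Complex.isPrimitiveRoot_exp 3 (by norm_num))
    have hη2 : orderOf (η ^ 2) = 3 := by
      rw [Nat.Coprime.orderOf_pow (by rw [hη]; norm_num), hη]
    have := natCast_card_affinePoint hη
    rw [sum_mulChar_eq_zero_of_not_nine_dvd hη h9,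
      sum_mulChar_eq_zero_of_not_nine_dvd hη2 h9] at this
    exact_mod_cast (by simpa using this : (Nat.card (AffinePoint F) : ℂ) = Fintype.card F)
  · exact card_affinePoint_of_not_three_dvd h3

-- As `χ(-1) = 1`, the summand is `χ(x³) χ³(1 - x³)`, a function of `t = x³`; the fibre over `t` has
-- `1 + χ³(t) + χ⁶(t)` elements. The exponents `12` and `21`, both `3` modulo `9`, display the
-- pattern `(i, 3i)`.
omit [DecidableEq F] in
theorem sum_mulChar_cube {χ : MulChar F R} (hχ : orderOf χ = 9) :
    ∑ x, (χ ^ 3) (x ^ 4 - x) =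
      jacobiSum χ (χ ^ 3) + jacobiSum (χ ^ 4) (χ ^ 12) + jacobiSum (χ ^ 7) (χ ^ 21) := by
  classical
  have h9 : χ ^ 9 = 1 := hχ ▸ pow_orderOf_eq_one χ
  have h12 : χ ^ 12 = χ ^ 3 := by rw [show 12 = 9 + 3 by norm_num, pow_add, h9, one_mul]
  have h21 : χ ^ 21 = χ ^ 3 := by
    rw [show 21 = 9 + (9 + 3) by norm_num, pow_add, pow_add, h9, one_mul, one_mul]
  have hη : orderOf (χ ^ 3) = 3 := by
    rw [orderOf_pow' _ (by norm_num), hχ]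
    norm_num
  have hneg : χ (-1) = 1 := by
    have h2 : χ (-1) ^ 2 = 1 := by rw [← map_pow, neg_one_sq, map_one]
    have h9' : χ (-1) ^ 9 = 1 := by
      rw [← MulChar.pow_apply' _ (by norm_num), h9, MulChar.one_apply isUnit_one.neg]
    calc χ (-1) = χ (-1) ^ 9 * (χ (-1)) := by rw [h9', one_mul]
      _ = (χ (-1) ^ 2) ^ 5 := by ring
      _ = 1 := by rw [h2, one_pow]
  have hterm : ∀ x : F, (χ ^ 3) (x ^ 4 - x) = χ (x ^ 3) * (χ ^ 3) (1 - x ^ 3) := by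
    intro x
    rw [show x ^ 4 - x = (-1) * (x * (1 - x ^ 3)) by ring, map_mul, map_mul,
      MulChar.pow_apply' χ (by norm_num) (-1), hneg, one_pow, one_mul,
      MulChar.pow_apply' χ (by norm_num) x, map_pow]
  rw [Finset.sum_congr rfl fun x _ => hterm x, h12, h21,
    ← Finset.sum_fiberwise (s := univ) (g := fun x : F => x ^ 3)]
  have hfib : ∀ t : F, ∑ x ∈ univ.filter (fun x : F => x ^ 3 = t), χ (x ^ 3) * (χ ^ 3) (1 - x ^ 3) =
      (1 + (χ ^ 3) t + ((χ ^ 3) ^ 2) t) * (χ t * (χ ^ 3) (1 - t)) := by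
    intro t
    rw [← card_cube_roots hη t, ← nsmul_eq_mul, ← Finset.sum_const]
    refine Finset.sum_congr rfl fun x hx => ?_
    rw [mem_filter] at hx
    rw [hx.2]
  rw [Finset.sum_congr rfl fun t _ => hfib t]
  simp only [jacobiSum, ← Finset.sum_add_distrib]
  refine Finset.sum_congr rfl fun t _ => ?_
  rw [← pow_mul]
  simp only [MulChar.pow_apply' χ (by norm_num : 3 ≠ 0), MulChar.pow_apply' χ (by norm_num : 4 ≠ 0),
    MulChar.pow_apply' χ (by norm_num : 7 ≠ 0), MulChar.pow_apply' χ (by norm_num : 3 * 2 ≠ 0)]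
  ring

theorem natCast_card_affinePoint_of_orderOf_eq_nine {χ : MulChar F R} (hχ : orderOf χ = 9) :
    (Nat.card (AffinePoint F) : R) = Fintype.card F +
      ∑ i ∈ ({1, 2, 4, 5, 7, 8} : Finset ℕ), jacobiSum (χ ^ i) (χ ^ (3 * i)) := by
  have h9 : χ ^ 9 = 1 := hχ ▸ pow_orderOf_eq_one χ
  have hη : orderOf (χ ^ 3) = 3 := by
    rw [orderOf_pow' _ (by norm_num), hχ]
    norm_num
  have hχ2 : orderOf (χ ^ 2) = 9 := by
    rw [Nat.Coprime.orderOf_pow (by rw [hχ]; norm_num), hχ]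
  -- The cubic character `χ³` gives the exponents `1, 4, 7`; its square is the cube of `χ²` and
  -- gives `2, 8, 14 ≡ 5`.
  rw [natCast_card_affinePoint hη, sum_mulChar_cube hχ, ← pow_mul, mul_comm 3 2, pow_mul,
    sum_mulChar_cube hχ2]
  simp only [← pow_mul]
  have e14 : χ ^ (2 * 7) = χ ^ 5 := by
    rw [show 2 * 7 = 9 + 5 by norm_num, pow_add, h9, one_mul]
  have e42 : χ ^ (2 * 21) = χ ^ (3 * 5) := by
    rw [show 2 * 21 = 9 + (9 + (9 + 3 * 5)) by norm_num, pow_add, pow_add, pow_add, h9]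
    simp
  rw [e14, e42, Finset.sum_insert (by decide), Finset.sum_insert (by decide),
    Finset.sum_insert (by decide), Finset.sum_insert (by decide), Finset.sum_insert (by decide),
    Finset.sum_singleton]
  norm_num
  ring

end PointCount

end PicardCM

namespace PicardCM

/-! ### Point counts over extensions, and residue characters of order nine -/

section Characters

open Finset

/-- The exponents prime to nine. -/
abbrev unitExponents : Finset ℕ := {1, 2, 4, 5, 7, 8}

variable {k : Type*} [Field k] [Fintype k] {R : Type*} [CommRing R] [IsDomain R]

theorem natCast_card_affinePoint_extension [CharZero R] (F : Type*) [Field F] [Finite F]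
    [Algebra k F] {χ : MulChar k R} (hχ : orderOf χ = 9) :
    (Nat.card (AffinePoint F) : R) = Nat.card F -
      ∑ i ∈ unitExponents, (-jacobiSum (χ ^ i) (χ ^ (3 * i))) ^ Module.finrank k F := by
  classical
  have := Fintype.ofFinite F
  rw [natCast_card_affinePoint_of_orderOf_eq_nine (χ := normLift F χ)
    (by rw [orderOf_normLift, hχ]), Nat.card_eq_fintype_card, sub_eq_add_neg,
    ← Finset.sum_neg_distrib]
  congr 1
  refine Finset.sum_congr rfl fun i hi => ?_
  rw [← normLift_pow, ← normLift_pow]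
  refine jacobiSum_normLift F _ fun h => ?_
  have := orderOf_dvd_of_pow_eq_one h
  rw [hχ] at this
  simp only [unitExponents, mem_insert, mem_singleton] at hi
  omega

/-- Since `f ∣ n`, any field `k` of order `p ^ f` embeds in `GaloisField p n` with degree `n / f`,
so the character may live on a residue field. -/
theorem natCast_card_affinePoint_galoisField [CharZero R] (p : ℕ) [Fact p.Prime] {f n : ℕ}
    (hk : Fintype.card k = p ^ f) (hn : n ≠ 0) (hfn : f ∣ n) {χ : MulChar k R}
    (hχ : orderOf χ = 9) :
    (Nat.card (AffinePoint (GaloisField p n)) : R) = (p : R) ^ n -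
      ∑ i ∈ unitExponents, (-jacobiSum (χ ^ i) (χ ^ (3 * i))) ^ (n / f) := by
  have hp : p.Prime := Fact.out
  have hf : f ≠ 0 := fun h => by
    rw [h, zero_dvd_iff] at hfn
    exact hn hfn
  have : CharP k p := by
    have h0 : (p : k) = 0 := by
      have h := Nat.cast_card_eq_zero k
      rw [hk, Nat.cast_pow] at h
      exact pow_eq_zero_iff hf |>.1 h
    exact (CharP.charP_iff_prime_eq_zero hp).2 h0
  let _ : Algebra (ZMod p) k := ZMod.algebra k p
  have hfk : Module.finrank (ZMod p) k = f := by
    have := FiniteField.pow_finrank_eq_card p k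
    rw [hk] at this
    exact Nat.pow_right_injective hp.two_le this
  have hcard : Nat.card (GaloisField p n) = p ^ n := GaloisField.card p n hn
  obtain ⟨φ⟩ := FiniteField.nonempty_algHom_of_finrank_dvd (F := ZMod p) (K := k)
    (L := GaloisField p n) (by rwa [hfk, GaloisField.finrank p hn])
  let _ : Algebra k (GaloisField p n) := φ.toRingHom.toAlgebra
  have hdeg : Module.finrank k (GaloisField p n) = n / f := by
    have h := Module.natCard_eq_pow_finrank (K := k) (V := GaloisField p n)
    rw [hcard, Nat.card_eq_fintype_card, hk, ← pow_mul] at h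
    have h' := Nat.pow_right_injective hp.two_le h
    exact (Nat.div_eq_of_eq_mul_right (Nat.pos_of_ne_zero hf) h').symm
  rw [natCast_card_affinePoint_extension (GaloisField p n) hχ, hcard, hdeg, Nat.cast_pow]

omit [IsDomain R] in
/-- The `n`-th power residue character attached to a ring homomorphism that is injective on the
`n`-th roots of unity. -/
theorem exists_residue_mulChar {n : ℕ} [NeZero n] (red : R →+* k) {z : R}
    (hz : IsPrimitiveRoot z n) (hzk : IsPrimitiveRoot (red z) n) :
    n ∣ Fintype.card k - 1 ∧ ∃ χ : MulChar k R, orderOf χ = n ∧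
      ∀ x : kˣ, red (χ x) = (x : k) ^ ((Fintype.card k - 1) / n) := by
  classical
  have hn : n ∣ Fintype.card k - 1 :=
    hzk.dvd_of_pow_eq_one _ (FiniteField.pow_card_sub_one_eq_one _ (hzk.ne_zero (NeZero.ne n)))
  refine ⟨hn, ?_⟩
  obtain ⟨g, hg⟩ := IsCyclic.exists_generator (α := kˣ)
  set e := (Fintype.card k - 1) / n with he
  have hne : e * n = Fintype.card k - 1 := Nat.div_mul_cancel hn
  have hcard0 : 0 < Fintype.card k - 1 := by
    have := Fintype.one_lt_card (α := k)
    omega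
  have hgo : orderOf g = Fintype.card k - 1 := by
    rw [orderOf_eq_card_of_forall_mem_zpowers hg, Nat.card_eq_fintype_card, Fintype.card_units]
  have hge : IsPrimitiveRoot ((g : k) ^ e) n :=
    (IsPrimitiveRoot.coe_units_iff.2 (hgo ▸ IsPrimitiveRoot.orderOf g)).pow hcard0 hne.symm
  -- The value of `χ` at the generator `g` must lift `g ^ e`; it is the power `z ^ j` with that
  -- reduction.
  obtain ⟨j, -, hj⟩ := hzk.eq_pow_of_pow_eq_one hge.pow_eq_one
  have hjn : j.Coprime n := by
    rw [← hzk.pow_iff_coprime (NeZero.pos n), hj]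
    exact hge
  have hμ : IsPrimitiveRoot (z ^ j) n := hz.pow_of_coprime j hjn
  have hu : hμ.toRootsOfUnity.val ∈ rootsOfUnity (Fintype.card kˣ) R := by
    rw [mem_rootsOfUnity, Fintype.card_units, ← hne, mul_comm, pow_mul,
      (mem_rootsOfUnity _ _).1 hμ.toRootsOfUnity.2, one_pow]
  have hspec : MulChar.ofRootOfUnity hu hg g = z ^ j := by
    rw [MulChar.ofRootOfUnity_spec]
    rfl
  refine ⟨MulChar.ofRootOfUnity hu hg, ?_, ?_⟩
  · refine Eq.trans (orderOf_eq_orderOf_iff.2 fun m => ?_) hμ.eq_orderOf.symm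
    rw [MulChar.eq_iff hg, MulChar.pow_apply_coe, MulChar.one_apply_coe, hspec]
  · intro x
    obtain ⟨m, rfl⟩ := (mem_powers_iff_mem_zpowers).2 (hg x)
    simp only [Units.val_pow_eq_pow_val, map_pow, hspec]
    rw [← map_pow, map_pow, hj, ← pow_mul, ← pow_mul, mul_comm]

-- After reduction `χ` is `x ↦ x ^ e`, so the Jacobi sum becomes a sum over `k` of a polynomial of
-- degree at most `e(a + b) < q - 1`, with `q` the order of `k`; such sums vanish monomial by
-- monomial.
omit [IsDomain R] in
theorem map_jacobiSum_eq_zero {n : ℕ} (red : R →+* k) {χ : MulChar k R}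
    (hn : n ∣ Fintype.card k - 1)
    (hχ : ∀ x : kˣ, red (χ x) = (x : k) ^ ((Fintype.card k - 1) / n)) {a b : ℕ} (ha : a ≠ 0)
    (hb : b ≠ 0) (hab : a + b < n) : red (jacobiSum (χ ^ a) (χ ^ b)) = 0 := by
  set e := (Fintype.card k - 1) / n with he
  have hne : e * n = Fintype.card k - 1 := Nat.div_mul_cancel hn
  have he0 : e ≠ 0 := by
    rintro h0
    rw [h0, zero_mul] at hne
    have := Fintype.one_lt_card (α := k)
    omega
  have hχ' : ∀ x : k, red (χ x) = x ^ e := by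
    intro x
    by_cases hx : x = 0
    · rw [hx, MulChar.map_zero, map_zero, zero_pow he0]
    · exact hχ (Units.mk0 x hx)
  have hJ : red (jacobiSum (χ ^ a) (χ ^ b)) =
      ∑ x : k, ((Polynomial.X ^ (e * a) * (1 - Polynomial.X) ^ (e * b) : Polynomial k)).eval x := by
    rw [jacobiSum, map_sum]
    refine Finset.sum_congr rfl fun x _ => ?_
    rw [MulChar.pow_apply' _ ha, MulChar.pow_apply' _ hb, map_mul, map_pow, map_pow, hχ', hχ']
    simp [pow_mul]
  rw [hJ]
  set Q : Polynomial k := Polynomial.X ^ (e * a) * (1 - Polynomial.X) ^ (e * b) with hQ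
  have hdeg : Q.natDegree < Fintype.card k - 1 := by
    have h1 : Q.natDegree ≤ e * a + e * b := by
      refine Polynomial.natDegree_mul_le.trans (add_le_add (Polynomial.natDegree_X_pow_le _) ?_)
      refine Polynomial.natDegree_pow_le.trans ?_
      have : (1 - Polynomial.X : Polynomial k).natDegree ≤ 1 :=
        (Polynomial.natDegree_sub_le _ _).trans (by simp)
      calc e * b * (1 - Polynomial.X : Polynomial k).natDegree ≤ e * b * 1 :=
            Nat.mul_le_mul_left _ this
        _ = e * b := mul_one _
    have h2 : e * (a + b) < e * n := Nat.mul_lt_mul_of_pos_left hab (Nat.pos_of_ne_zero he0)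
    rw [← hne]
    linarith [mul_add e a b]
  simp only [Polynomial.eval_eq_sum_range]
  rw [Finset.sum_comm]
  refine Finset.sum_eq_zero fun i hi => ?_
  rw [← Finset.mul_sum, FiniteField.sum_pow_lt_card_sub_one k i, mul_zero]
  rw [Finset.mem_range] at hi
  omega

/-- The congruence `-J(χ, ψ) ≡ q` modulo any `d` dividing all `(χ(x) - 1)(ψ(1 - x) - 1)`. -/
theorem dvd_jacobiSum_add_card {χ ψ : MulChar k R} (hχ : χ ≠ 1) (hψ : ψ ≠ 1) {d : R}
    (hd : ∀ x : k, x ≠ 0 → x ≠ 1 → d ∣ (χ x - 1) * (ψ (1 - x) - 1)) :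
    d ∣ jacobiSum χ ψ + Fintype.card k := by
  classical
  -- Expanding the right side gives `J + 1 + 1 + (q - 2)`, because each complete character sum is
  -- zero.
  have key : jacobiSum χ ψ + Fintype.card k =
      ∑ x ∈ univ \ {0, 1}, (χ x - 1) * (ψ (1 - x) - 1) := by
    have h1 : ∑ x ∈ univ \ {0, 1}, χ x = -1 := by
      have := MulChar.sum_eq_zero_of_ne_one hχ
      rw [← Finset.sum_sdiff (subset_univ ({0, 1} : Finset k)), Finset.sum_pair zero_ne_one,
        MulChar.map_zero, MulChar.map_one] at this
      linear_combination this
    have h2 : ∑ x ∈ univ \ {0, 1}, ψ (1 - x) = -1 := by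
      have := MulChar.sum_eq_zero_of_ne_one hψ
      rw [← Equiv.sum_comp (Equiv.subLeft (1 : k))] at this
      rw [← Finset.sum_sdiff (subset_univ ({0, 1} : Finset k)), Finset.sum_pair zero_ne_one] at this
      simp only [Equiv.subLeft_apply, sub_zero, sub_self, MulChar.map_zero, MulChar.map_one] at this
      linear_combination this
    have h3 : ((univ \ {0, 1} : Finset k).card : R) = Fintype.card k - 2 := by
      have h := Finset.card_sdiff_add_card_eq_card (subset_univ ({0, 1} : Finset k))
      rw [Finset.card_pair zero_ne_one, card_univ] at h
      rw [← h]
      push_cast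
      ring
    have h4 : ∀ x : k, (χ x - 1) * (ψ (1 - x) - 1) = χ x * ψ (1 - x) - χ x - ψ (1 - x) + 1 :=
      fun x => by ring
    rw [Finset.sum_congr rfl fun x _ => h4 x, Finset.sum_add_distrib, Finset.sum_sub_distrib,
      Finset.sum_sub_distrib, ← jacobiSum_eq_sum_sdiff, h1, h2, Finset.sum_const, nsmul_eq_mul, h3]
    ring
  rw [key]
  refine Finset.dvd_sum fun x hx => ?_
  simp only [mem_sdiff, mem_univ, true_and, mem_insert, mem_singleton, not_or] at hx
  exact hd x hx.1 hx.2

omit [IsDomain R] in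
/-- Jacobi sums are invariant under the Frobenius. -/
theorem jacobiSum_pow_char (p : ℕ) [Fact p.Prime] [CharP k p] (χ ψ : MulChar k R) :
    jacobiSum (χ ^ p) (ψ ^ p) = jacobiSum χ ψ := by
  have hp : p ≠ 0 := (Fact.out : p.Prime).ne_zero
  have hbij : Function.Bijective (frobenius k p) :=
    Finite.injective_iff_bijective.1 (frobenius_inj k p)
  rw [jacobiSum, jacobiSum, ← hbij.sum_comp (fun x => χ x * ψ (1 - x))]
  refine Finset.sum_congr rfl fun x _ => ?_
  rw [MulChar.pow_apply' _ hp, MulChar.pow_apply' _ hp, ← map_pow, ← map_pow, frobenius_def,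
    sub_pow_char, one_pow]

end Characters

end PicardCM

namespace PicardCM

/-! ### Arithmetic of the ring of integers of the ninth cyclotomic field -/

section Cyclotomic

open NumberField IsCyclotomicExtension.Rat

section Relations

variable {R : Type*} [CommRing R] {z : R}

/-- Total ramification of `3` in explicit form; the cofactor is a unit for `z = ζ`. -/
theorem three_eq_sub_one_pow_mul (h : z ^ 6 + z ^ 3 + 1 = 0) :
    (3 : R) = (z - 1) ^ 6 * (10 + 11 * z + 7 * z ^ 2 + 10 * z ^ 3 + 4 * z ^ 4 - 4 * z ^ 5) := by
  linear_combination (-7 + 49 * z - 91 * z ^ 2 + 74 * z ^ 3 - 28 * z ^ 4 + 4 * z ^ 5) * h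

theorem associated_sub_one_one_add (h : z ^ 6 + z ^ 3 + 1 = 0) :
    Associated (z - 1) (1 + z + z ^ 4) := by
  refine ⟨⟨-z - z ^ 2 - z ^ 4 - z ^ 5, -1 + z - z ^ 3 + z ^ 4 - z ^ 5, ?_, ?_⟩, ?_⟩
  · linear_combination (-1 + z + z ^ 4) * h
  · linear_combination (-1 + z + z ^ 4) * h
  · linear_combination -h

/-- Powers of `z` alone do not reach the second layer of the filtration by powers of `z - 1`; this
supplies a unit `v ≡ 1 - (z - 1)²` modulo `(z - 1)³`. -/
theorem exists_unit_second_layer (h : z ^ 6 + z ^ 3 + 1 = 0) :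
    ∃ v : Rˣ, (z - 1) ^ 3 ∣ v - 1 + (z - 1) ^ 2 := by
  refine ⟨⟨-z + z ^ 2 + z ^ 5, -1 - z + z ^ 2 - z ^ 4, ?_, ?_⟩,
    -4 - 3 * z - z ^ 2 - 2 * z ^ 3 + 2 * z ^ 5, ?_⟩
  · linear_combination (-1 + z - z ^ 3) * h
  · linear_combination (-1 + z - z ^ 3) * h
  · linear_combination (-4 + 6 * z - 2 * z ^ 2) * h

theorem dvd_cube_third_layer (h : z ^ 6 + z ^ 3 + 1 = 0) :
    (z - 1) ^ 4 ∣ z ^ 3 - 1 - (z - 1) ^ 3 :=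
  ⟨3 + 4 * z + 3 * z ^ 2 + 3 * z ^ 3 + 2 * z ^ 4, by
    linear_combination (-3 + 5 * z - 2 * z ^ 2) * h⟩

/-- One step of the approximation of `1` by unit multiples of `x`. -/
theorem exists_unit_mul_sub_one_dvd {l x : R} {n : ℕ} (hn : n ≠ 0) (h3 : l ∣ 3)
    (htri : ∀ y : R, l ∣ y ∨ l ∣ y - 1 ∨ l ∣ y + 1) (hx : l ^ n ∣ x - 1) {v : Rˣ} {e : R}
    (he : e ^ 2 = 1) (hv : l ^ (n + 1) ∣ v - 1 - e * l ^ n) :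
    ∃ u : Rˣ, l ^ (n + 1) ∣ u * x - 1 := by
  obtain ⟨y, hy⟩ := hx
  obtain ⟨w, hw⟩ := hv
  obtain ⟨t, ht⟩ := h3
  obtain ⟨m, rfl⟩ : ∃ m, n = m + 1 := Nat.exists_eq_succ_of_ne_zero hn
  have hx' : x = 1 + l ^ (m + 1) * y := by linear_combination hy
  have hv' : (v : R) = 1 + e * l ^ (m + 1) + l ^ (m + 1 + 1) * w := by linear_combination hw
  -- Multiplying `x = 1 + lⁿ y` by `v ^ j` replaces `y` by `y + j e` modulo `l`. As `e² = 1` and `l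
  -- ∣ 3`, the exponents `0, 2, 1` work for `y e ≡ 0, 1, -1`.
  rcases htri (y * e) with ⟨c, hc⟩ | ⟨c, hc⟩ | ⟨c, hc⟩
  · refine ⟨1, e * c, ?_⟩
    rw [hx', Units.val_one]
    linear_combination l ^ (m + 1) * e * hc - l ^ (m + 1) * y * he
  · refine ⟨v ^ 2, ?_⟩
    have hy' : y = e + e * l * c := by linear_combination e * hc - y * he
    rw [Units.val_pow_eq_pow_val, hx', hv', hy']
    refine ⟨e * c + t * e + 2 * w + l ^ m * (e + l * w) ^ 2 +
      l ^ m * (2 * e + 2 * l * w + l ^ (m + 1) * (e + l * w) ^ 2) * (e + e * l * c), ?_⟩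
    linear_combination e * l ^ (m + 1) * ht
  · refine ⟨v, ?_⟩
    have hy' : y = -e + e * l * c := by linear_combination e * hc - y * he
    rw [hx', hv', hy']
    refine ⟨e * c + w + l ^ m * (e + l * w) * (-e + e * l * c), ?_⟩
    ring

/-- Units surject onto the units modulo `(z - 1)⁴`, one layer at a time: `-1` handles the residue
field, and `z`, `v`, `z³` the layers one, two, three. -/
theorem exists_unit_mul_sub_one_dvd_pow_four (h : z ^ 6 + z ^ 3 + 1 = 0)
    (htri : ∀ y : R, z - 1 ∣ y ∨ z - 1 ∣ y - 1 ∨ z - 1 ∣ y + 1) {x : R} (hx : ¬ z - 1 ∣ x) :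
    ∃ u : Rˣ, (z - 1) ^ 4 ∣ u * x - 1 := by
  have h3 : z - 1 ∣ 3 := ⟨_, by rw [three_eq_sub_one_pow_mul h, pow_succ', mul_assoc]⟩
  have hz : IsUnit z := IsUnit.of_mul_eq_one (-z ^ 5 - z ^ 2) (by linear_combination -h)
  obtain ⟨u₀, hu₀⟩ : ∃ u : Rˣ, (z - 1) ^ 1 ∣ u * x - 1 := by
    rcases htri x with h | h | h
    · exact absurd h hx
    · exact ⟨1, by simpa using h⟩
    · refine ⟨-1, ?_⟩
      rw [pow_one, Units.val_neg, Units.val_one, neg_one_mul, ← neg_add', dvd_neg]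
      exact h
  obtain ⟨u₁, hu₁⟩ := exists_unit_mul_sub_one_dvd one_ne_zero h3 htri hu₀ (v := hz.unit) (e := 1)
    (one_pow 2) (by rw [IsUnit.unit_spec]; ring_nf; exact dvd_zero _)
  obtain ⟨v, hv⟩ := exists_unit_second_layer h
  obtain ⟨u₂, hu₂⟩ := exists_unit_mul_sub_one_dvd two_ne_zero h3 htri hu₁ (v := v) (e := -1)
    (by ring) (by convert hv using 1; ring)
  obtain ⟨u₃, hu₃⟩ := exists_unit_mul_sub_one_dvd three_ne_zero h3 htri hu₂ (v := hz.unit ^ 3)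
    (e := 1) (one_pow 2)
    (by
      rw [Units.val_pow_eq_pow_val, IsUnit.unit_spec, one_mul]
      exact dvd_cube_third_layer h)
  exact ⟨u₃ * u₂ * u₁ * u₀, by simpa [mul_assoc] using hu₃⟩

end Relations

/-! ### Residues, units and class number of the ninth cyclotomic field -/

variable {K : Type*} [Field K] [NumberField K] [IsCyclotomicExtension {9} ℚ K] {ζ : K}
  (hζ : IsPrimitiveRoot ζ 9)

theorem isCyclotomicExtension_three_pow (K : Type*) [Field K] [NumberField K]
    [h : IsCyclotomicExtension {9} ℚ K] : IsCyclotomicExtension {3 ^ (1 + 1)} ℚ K := h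

include hζ in
omit [NumberField K] [IsCyclotomicExtension {9} ℚ K] in
theorem toInteger_relation : hζ.toInteger ^ 6 + hζ.toInteger ^ 3 + 1 = 0 := by
  have hz := hζ.toInteger_isPrimitiveRoot
  have h3 : hζ.toInteger ^ 3 - 1 ≠ 0 :=
    sub_ne_zero.2 (hz.pow_ne_one_of_pos_of_lt (by norm_num) (by norm_num))
  refine mul_left_cancel₀ h3 ?_
  linear_combination hz.pow_eq_one

theorem prime_toInteger_sub_one : Prime (hζ.toInteger - 1) := by
  have := isCyclotomicExtension_three_pow K
  have : Fact (Nat.Prime 3) := ⟨by norm_num⟩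
  exact IsPrimitiveRoot.zeta_sub_one_prime (p := 3) (k := 1) hζ

/-- The residue field at `λ` is `𝔽₃`: every integer is `f(ζ)` with `f` over `ℤ`, and `f(ζ) ≡ f(1)`
modulo `λ`. -/
theorem sub_one_dvd_trichotomy (y : 𝓞 K) :
    hζ.toInteger - 1 ∣ y ∨ hζ.toInteger - 1 ∣ y - 1 ∨ hζ.toInteger - 1 ∣ y + 1 := by
  have hy : y ∈ Algebra.adjoin ℤ {hζ.toInteger} := by
    rw [adjoin_singleton_eq_top hζ]
    exact Algebra.mem_top
  rw [Algebra.adjoin_singleton_eq_range_aeval] at hy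
  obtain ⟨f, rfl⟩ := hy
  have h1 : hζ.toInteger - 1 ∣ Polynomial.aeval hζ.toInteger f - ((f.eval 1 : ℤ) : 𝓞 K) := by
    have := Polynomial.sub_dvd_eval_sub hζ.toInteger 1 (f.map (algebraMap ℤ (𝓞 K)))
    rwa [Polynomial.eval_map_algebraMap, Polynomial.eval_map_algebraMap,
      ← map_one (algebraMap ℤ (𝓞 K)), Polynomial.aeval_algebraMap_apply, map_one, eq_intCast,
      Polynomial.coe_aeval_eq_eval] at this
  have h3 : hζ.toInteger - 1 ∣ ((3 : ℤ) : 𝓞 K) := by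
    push_cast
    exact ⟨_, by rw [three_eq_sub_one_pow_mul (toInteger_relation hζ), pow_succ', mul_assoc]⟩
  have key : ∀ c : ℤ, (3 : ℤ) ∣ f.eval 1 - c →
      hζ.toInteger - 1 ∣ Polynomial.aeval hζ.toInteger f - (c : 𝓞 K) := by
    rintro c ⟨d, hd⟩
    have h2 : hζ.toInteger - 1 ∣ ((f.eval 1 - c : ℤ) : 𝓞 K) := by
      rw [hd, Int.cast_mul]
      exact h3.mul_right _
    have := dvd_add h1 h2
    push_cast at this
    simpa using this
  rcases (by omega : (3 : ℤ) ∣ f.eval 1 - 0 ∨ (3 : ℤ) ∣ f.eval 1 - 1 ∨ (3 : ℤ) ∣ f.eval 1 - (-1))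
    with h | h | h
  · exact Or.inl (by simpa using key _ h)
  · exact Or.inr (Or.inl (by simpa using key _ h))
  · exact Or.inr (Or.inr (by simpa using key _ h))

theorem exists_unit_congr_one {x : 𝓞 K} (hx : ¬ hζ.toInteger - 1 ∣ x) :
    ∃ u : (𝓞 K)ˣ, (hζ.toInteger - 1) ^ 4 ∣ u * x - 1 :=
  exists_unit_mul_sub_one_dvd_pow_four (toInteger_relation hζ) (sub_one_dvd_trichotomy hζ) hx

omit [NumberField K] [IsCyclotomicExtension {9} ℚ K] in
theorem modulus_eq_span : modulus hζ = Ideal.span {(hζ.toInteger - 1) ^ 4} := by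
  rw [modulus, ← Ideal.span_singleton_pow]
  congr 1
  exact (Ideal.span_singleton_eq_span_singleton.2
    (associated_sub_one_one_add (toInteger_relation hζ))).symm

omit [IsCyclotomicExtension {9} ℚ K] in
theorem sub_one_pow_dvd_smul {n : ℕ} {x : 𝓞 K} (σ : Gal(K/ℚ))
    (h : (hζ.toInteger - 1) ^ n ∣ x) : (hζ.toInteger - 1) ^ n ∣ σ • x := by
  have h1 : hζ.toInteger - 1 ∣ σ • (hζ.toInteger - 1) := by
    have hσ : (σ • hζ.toInteger) ^ 9 = 1 := by
      rw [← smul_pow', hζ.toInteger_isPrimitiveRoot.pow_eq_one, smul_one]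
    obtain ⟨i, -, hi⟩ := hζ.toInteger_isPrimitiveRoot.eq_pow_of_pow_eq_one hσ
    rw [smul_sub, smul_one, ← hi]
    exact sub_one_dvd_pow_sub_one _ _
  obtain ⟨y, rfl⟩ := h
  rw [smul_mul', smul_pow']
  exact (pow_dvd_pow_of_dvd h1 n).mul_right _

/-- Roots of unity are `±ζ^r`, and the minus sign would give `λ ∣ 2`. A primitive cube root of unity
`v ≡ 1` modulo `λ⁴` would give `λ⁸ ∣ (v - 1)(v² - 1) = 3`, whereas `3` has valuation six. This is
applied to `u³` and then to `u`. -/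
theorem eq_one_of_isOfFinOrder {u : 𝓞 K} (hu : IsOfFinOrder u)
    (h : (hζ.toInteger - 1) ^ 4 ∣ u - 1) : u = 1 := by
  have hl := prime_toInteger_sub_one hζ
  have hΦ := toInteger_relation hζ
  have h3 := three_eq_sub_one_pow_mul hΦ
  have hl3 : hζ.toInteger - 1 ∣ 3 := ⟨_, by rw [h3, pow_succ', mul_assoc]⟩
  have hl2 : ¬ hζ.toInteger - 1 ∣ 2 := fun h2 => hl.not_isUnit (isUnit_of_dvd_one (by
    have := dvd_sub hl3 h2
    norm_num at this
    exact this))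
  have hz := hζ.toInteger_isPrimitiveRoot.pow_eq_one
  have h9 : u ^ 9 = 1 := by
    obtain ⟨r, -, hr | hr⟩ := hζ.exists_pow_or_neg_mul_pow_of_isOfFinOrder (by decide)
      ((RingOfIntegers.coe_injective (K := K)).isOfFinOrder_iff (f := algebraMap (𝓞 K) K) |>.2 hu)
    · have hr' : u = hζ.toInteger ^ r := RingOfIntegers.ext hr
      rw [hr', pow_right_comm, hz, one_pow]
    · have hr' : u = -hζ.toInteger ^ r := RingOfIntegers.ext hr
      have h1 : hζ.toInteger - 1 ∣ u - 1 := (dvd_pow_self _ (by norm_num)).trans h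
      have h2 := sub_one_dvd_pow_sub_one hζ.toInteger r
      refine absurd ?_ hl2
      have := (dvd_add h1 h2)
      rw [hr'] at this
      rw [← dvd_neg]
      convert this using 1
      ring
  have hcube : ∀ v : 𝓞 K, (hζ.toInteger - 1) ^ 4 ∣ v - 1 → v ^ 3 = 1 → v = 1 := by
    intro v hv hv3
    by_contra hne
    have hrel : v ^ 2 + v + 1 = 0 := by
      refine mul_left_cancel₀ (sub_ne_zero.2 hne) ?_
      linear_combination hv3
    have h8 : (hζ.toInteger - 1) ^ 6 * (hζ.toInteger - 1) ^ 2 ∣ 3 := by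
      have := mul_dvd_mul hv (hv.trans (sub_one_dvd_pow_sub_one v 2))
      rw [← pow_add] at this ⊢
      convert this using 1
      linear_combination hrel - hv3
    rw [h3] at h8
    have hw := (dvd_pow_self _ two_ne_zero).trans
      ((mul_dvd_mul_iff_left (pow_ne_zero 6 hl.ne_zero)).1 h8)
    have hp : ∀ i, hζ.toInteger - 1 ∣ hζ.toInteger ^ i - 1 := sub_one_dvd_pow_sub_one _
    refine hl2 ?_
    -- `38` is the value at `z = 1` of the cofactor in `three_eq_sub_one_pow_mul`.
    have h38 : hζ.toInteger - 1 ∣ 38 := by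
      have := dvd_sub hw (dvd_add (dvd_add (dvd_add (dvd_add ((hp 1).mul_left 11)
        ((hp 2).mul_left 7)) ((hp 3).mul_left 10)) ((hp 4).mul_left 4)) ((hp 5).mul_left (-4)))
      convert this using 1
      ring
    have := dvd_sub h38 (hl3.mul_left 12)
    norm_num at this
    exact this
  refine hcube u h (hcube (u ^ 3) (h.trans (sub_one_dvd_pow_sub_one u 3)) ?_)
  rw [← pow_mul]
  exact h9

/-- The ring of integers of the ninth cyclotomic field is a principal ideal domain. -/
theorem nine_pid (K : Type*) [Field K] [NumberField K] [IsCyclotomicExtension {9} ℚ K] :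
    IsPrincipalIdealRing (𝓞 K) := by
  have := isCyclotomicExtension_three_pow K
  have h3 : Fact (Nat.Prime 3) := ⟨by norm_num⟩
  have h2 : Fact (Nat.Prime 2) := ⟨by norm_num⟩
  have hζ := IsCyclotomicExtension.zeta_spec 9 ℚ K
  -- The Minkowski bound, with discriminant of absolute value `3⁹ = 19683`, is below five, so only
  -- primes above `2` and `3` matter.
  have hM : ⌊(4 / Real.pi) ^ InfinitePlace.nrComplexPlaces K *
      (((Module.finrank ℚ K).factorial : ℝ) / (Module.finrank ℚ K : ℝ) ^ Module.finrank ℚ K *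
        √|(discr K : ℝ)|)⌋₊ ≤ 4 := by
    have htot : Nat.totient 9 = 6 := by decide
    rw [nrComplexPlaces_eq_totient_div_two 9, discr_prime_pow_succ 3 1 K,
      IsCyclotomicExtension.finrank (n := 9) K
        (Polynomial.cyclotomic.irreducible_rat (by norm_num)),
      htot, ← Nat.lt_succ_iff]
    refine (Nat.floor_lt (by positivity)).2 ?_
    norm_num [Nat.factorial]
    have hpi : (4 / Real.pi) ^ 3 ≤ (4 / 3.14) ^ 3 := by
      gcongr
      exact Real.pi_gt_d2.le
    have hsq : √(19683 : ℝ) ≤ 141 := by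
      rw [Real.sqrt_le_left (by norm_num)]
      norm_num
    calc (4 / Real.pi) ^ 3 * (5 / 324 * √(19683 : ℝ))
        ≤ (4 / 3.14) ^ 3 * (5 / 324 * 141) := by gcongr
      _ < 5 := by norm_num
  refine RingOfIntegers.isPrincipalIdealRing_of_isPrincipal_of_pow_le_of_mem_primesOver_of_mem_Icc
    fun p hp hpp P hP hle => ?_
  have hp4 := (Finset.mem_Icc.1 hp).2.trans hM
  have hle4 := hle.trans hM
  have := hP.1
  have := hP.2
  have hp2 := hpp.two_le
  interval_cases p
  -- `2` generates the units modulo `9`, so it is inert and its norm `64` exceeds the bound.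
  · have hdeg : P.inertiaDeg ℤ = 6 := by
      rw [inertiaDeg_eq_of_not_dvd (m := 9) 2 K P (by decide), orderOf_eq_iff (by norm_num)]
      decide
    rw [hdeg] at hle4
    norm_num at hle4
  · rw [eq_span_zeta_sub_one_of_liesOver 3 1 K hζ P]
    exact ⟨_, rfl⟩
  · exact absurd hpp (by norm_num)

end Cyclotomic

end PicardCM

namespace PicardCM

/-! ### The Galois action and elements of CM type -/

section GaloisAction

open NumberField IsCyclotomicExtension.Rat
open scoped Pointwise

variable (K : Type*) [Field K] [NumberField K] [IsCyclotomicExtension {9} ℚ K]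

/-- The automorphism of the ninth cyclotomic field raising roots of unity to the power `u`. -/
noncomputable def gal (u : (ZMod 9)ˣ) : Gal(K/ℚ) := (galEquivZMod 9 K).symm u

theorem gal_mul (u v : (ZMod 9)ˣ) : gal K (u * v) = gal K u * gal K v := map_mul _ _ _

theorem gal_one : gal K 1 = 1 := map_one _

theorem gal_inv (u : (ZMod 9)ˣ) : gal K u⁻¹ = (gal K u)⁻¹ := map_inv _ _

@[simp]
theorem galEquivZMod_gal (u : (ZMod 9)ˣ) : galEquivZMod 9 K (gal K u) = u :=
  (galEquivZMod 9 K).apply_symm_apply u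

@[simp]
theorem gal_galEquivZMod (σ : Gal(K/ℚ)) : gal K (galEquivZMod 9 K σ) = σ :=
  (galEquivZMod 9 K).symm_apply_apply σ

theorem gal_injective : Function.Injective (gal K) := (galEquivZMod 9 K).symm.injective

variable {K}

theorem gal_smul_smul (u v : (ZMod 9)ˣ) (x : 𝓞 K) : gal K u • gal K v • x = gal K (u * v) • x := by
  rw [gal_mul, mul_smul]

theorem gal_smul_of_pow_eq_one (u : (ZMod 9)ˣ) {x : 𝓞 K} (hx : x ^ 9 = 1) :
    gal K u • x = x ^ u.val.val := by
  rw [galEquivZMod_smul_of_pow_eq 9 K _ hx, galEquivZMod_gal]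

/-- The unit `5` modulo `9`. -/
abbrev u5 : (ZMod 9)ˣ := ⟨5, 2, by decide, by decide⟩

/-- The unit `7` modulo `9`. -/
abbrev u7 : (ZMod 9)ˣ := ⟨7, 4, by decide, by decide⟩

/-- The unit `2` modulo `9`. -/
abbrev u2 : (ZMod 9)ˣ := ⟨2, 5, by decide, by decide⟩

/-- The unit `4` modulo `9`. -/
abbrev u4 : (ZMod 9)ˣ := ⟨4, 7, by decide, by decide⟩

theorem univ_units_zmod_nine : (Finset.univ : Finset (ZMod 9)ˣ) = {1, u5, u7, -1, u4, u2} := by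
  decide

theorem prod_gal {M : Type*} [CommMonoid M] (f : Gal(K/ℚ) → M) :
    ∏ σ, f σ = ∏ u, f (gal K u) :=
  (Equiv.prod_comp (galEquivZMod 9 K).symm.toEquiv f).symm

theorem gal_smul_coe (u : (ZMod 9)ˣ) (x : 𝓞 K) :
    algebraMap (𝓞 K) K (gal K u • x) = gal K u (algebraMap (𝓞 K) K x) := rfl

theorem mem_typeΦ_iff {ζ : K} (hζ : IsPrimitiveRoot ζ 9) (σ : Gal(K/ℚ)) :
    σ ∈ typeΦ ζ ↔ galEquivZMod 9 K σ = 1 ∨ galEquivZMod 9 K σ = u5 ∨ galEquivZMod 9 K σ = u7 := by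
  have h : ∀ (i : ℕ), i < 9 → (σ ζ = ζ ^ i ↔ (galEquivZMod 9 K σ).val.val = i) := by
    intro i hi
    rw [galEquivZMod_apply_of_pow_eq 9 K σ hζ.pow_eq_one]
    exact ⟨fun h => hζ.pow_inj (ZMod.val_lt _) hi h, fun h => by rw [h]⟩
  have h2 : ∀ u : (ZMod 9)ˣ, (u.val.val = 1 ∨ u.val.val = 5 ∨ u.val.val = 7) ↔
      (u = 1 ∨ u = u5 ∨ u = u7) := by decide
  simp only [typeΦ, Finset.mem_filter, Finset.mem_univ, true_and]
  rw [h 1 (by norm_num), h 5 (by norm_num), h 7 (by norm_num), h2]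

theorem typeΦ_eq {ζ : K} (hζ : IsPrimitiveRoot ζ 9) :
    typeΦ ζ = ({1, u5, u7} : Finset (ZMod 9)ˣ).map
      ⟨gal K, gal_injective K⟩ := by
  ext σ
  rw [mem_typeΦ_iff hζ]
  simp only [Finset.mem_map, Finset.mem_insert, Finset.mem_singleton]
  constructor
  · intro h
    exact ⟨_, h, gal_galEquivZMod K σ⟩
  · rintro ⟨u, hu, rfl⟩
    change galEquivZMod 9 K (gal K u) = 1 ∨ galEquivZMod 9 K (gal K u) = u5 ∨
      galEquivZMod 9 K (gal K u) = u7
    rwa [galEquivZMod_gal]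

/-- The product of the conjugates of `x` over the CM type `{σ₁, σ₅, σ₇}`. -/
noncomputable def cmNorm (x : 𝓞 K) : 𝓞 K := x * gal K u5 • x * gal K u7 • x

theorem prod_typeΦ {ζ : K} (hζ : IsPrimitiveRoot ζ 9) (x : 𝓞 K) :
    ∏ σ ∈ typeΦ ζ, σ (x : K) = (cmNorm x : 𝓞 K) := by
  rw [typeΦ_eq hζ, Finset.prod_map, Finset.prod_insert (by decide), Finset.prod_insert (by decide),
    Finset.prod_singleton, cmNorm, mul_assoc]
  simp only [Function.Embedding.coeFn_mk, gal_one]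
  rfl

theorem gal_smul_cmNorm (u : (ZMod 9)ˣ) (x : 𝓞 K) : gal K u • cmNorm x = cmNorm (gal K u • x) := by
  simp only [cmNorm, smul_mul', gal_smul_smul, mul_comm u]

/-- The automorphism `σ₋₁` is complex conjugation under every embedding. -/
theorem map_gal_neg_one (φ : K →+* ℂ) (x : K) : φ (gal K (-1) x) = starRingEnd ℂ (φ x) := by
  have hζ := IsCyclotomicExtension.zeta_spec 9 ℚ K
  have h : RingHom.toRatAlgHom (φ.comp (MulSemiringAction.toRingHom Gal(K/ℚ) K (gal K (-1)))) =
      RingHom.toRatAlgHom ((starRingEnd ℂ).comp φ) := by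
    refine (hζ.powerBasis ℚ).algHom_ext ?_
    rw [hζ.powerBasis_gen ℚ]
    change φ (gal K (-1) (IsCyclotomicExtension.zeta 9 ℚ K)) =
      starRingEnd ℂ (φ (IsCyclotomicExtension.zeta 9 ℚ K))
    have h8 : gal K (-1) (IsCyclotomicExtension.zeta 9 ℚ K) =
        (IsCyclotomicExtension.zeta 9 ℚ K) ^ 8 := by
      rw [galEquivZMod_apply_of_pow_eq 9 K _ hζ.pow_eq_one, galEquivZMod_gal]
      rfl
    have h9 : φ (IsCyclotomicExtension.zeta 9 ℚ K) ^ 9 = 1 := by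
      rw [← map_pow, hζ.pow_eq_one, map_one]
    rw [h8, map_pow, ← Complex.inv_eq_conj (Complex.norm_eq_one_of_pow_eq_one h9 (by norm_num))]
    refine eq_inv_of_mul_eq_one_left ?_
    rw [← pow_succ, h9]
  exact DFunLike.congr_fun h x

theorem map_mul_gal_neg_one (φ : K →+* ℂ) (x : 𝓞 K) :
    φ (algebraMap (𝓞 K) K (x * gal K (-1) • x)) =
      ((‖φ (algebraMap (𝓞 K) K x)‖ ^ 2 : ℝ) : ℂ) := by
  rw [map_mul, map_mul, gal_smul_coe, map_gal_neg_one, Complex.mul_conj, Complex.normSq_eq_norm_sq]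

/-- Kronecker's theorem: `x` has absolute value one under every embedding. -/
theorem isOfFinOrder_of_mul_gal_eq_one {x : 𝓞 K} (hx : x * gal K (-1) • x = 1) :
    IsOfFinOrder x := by
  obtain ⟨n, hn, hxn⟩ := Embeddings.pow_eq_one_of_norm_eq_one K ℂ x.isIntegral_coe fun φ => by
    have h := map_mul_gal_neg_one φ x
    rw [hx, map_one, map_one] at h
    have h' : ‖φ (algebraMap (𝓞 K) K x)‖ ^ 2 = 1 := by exact_mod_cast h.symm
    exact (pow_eq_one_iff_of_nonneg (norm_nonneg _) two_ne_zero).1 h'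
  exact isOfFinOrder_iff_pow_eq_one.2 ⟨n, hn, RingOfIntegers.ext (by simpa using hxn)⟩

/-- `{1, 5, 7}` and its negative `{8, 4, 2}` partition the units modulo `9`, as a CM type must. -/
theorem cmNorm_mul_gal_neg_one (x : 𝓞 K) :
    cmNorm x * gal K (-1) • cmNorm x = ∏ u : (ZMod 9)ˣ, gal K u • x := by
  rw [univ_units_zmod_nine, Finset.prod_insert (by decide), Finset.prod_insert (by decide),
    Finset.prod_insert (by decide), Finset.prod_insert (by decide), Finset.prod_insert (by decide),
    Finset.prod_singleton, gal_smul_cmNorm, cmNorm, cmNorm, gal_smul_smul, gal_smul_smul,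
    show u5 * -1 = u4 by decide, show u7 * -1 = u2 by decide, gal_one, one_smul]
  ring

theorem cmNorm_mul_gal_neg_one_eq_absNorm (x : 𝓞 K) :
    cmNorm x * gal K (-1) • cmNorm x = (Ideal.absNorm (Ideal.span {x}) : 𝓞 K) := by
  have : IsGalois ℚ K := IsCyclotomicExtension.isGalois {9} ℚ K
  have h1 : algebraMap (𝓞 K) K (cmNorm x * gal K (-1) • cmNorm x) =
      ((Algebra.norm ℤ x : ℤ) : K) := by
    rw [cmNorm_mul_gal_neg_one, map_prod]
    have h := Algebra.norm_eq_prod_automorphisms ℚ (algebraMap (𝓞 K) K x)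
    rw [← Algebra.coe_norm_int, prod_gal] at h
    simp only [gal_smul_coe]
    rw [← h]
    simp
  have hpos : 0 ≤ Algebra.norm ℤ x := by
    obtain ⟨φ⟩ : Nonempty (K →+* ℂ) := inferInstance
    have h2 := map_mul_gal_neg_one φ (cmNorm x)
    rw [h1, map_intCast] at h2
    have h3 : ((Algebra.norm ℤ x : ℤ) : ℝ) = ‖φ (algebraMap (𝓞 K) K (cmNorm x))‖ ^ 2 := by
      exact_mod_cast h2
    have h4 : (0 : ℝ) ≤ ((Algebra.norm ℤ x : ℤ) : ℝ) := h3 ▸ by positivity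
    exact_mod_cast h4
  refine RingOfIntegers.ext (h1.trans ?_)
  rw [Ideal.absNorm_span_singleton]
  have h5 : (((Algebra.norm ℤ x).natAbs : ℤ) : K) = ((Algebra.norm ℤ x : ℤ) : K) := by
    rw [Int.natAbs_of_nonneg hpos]
  rw [← h5]
  simp

omit [IsCyclotomicExtension {9} ℚ K] in
theorem smul_span_singleton (σ : Gal(K/ℚ)) (x : 𝓞 K) :
    σ • (Ideal.span {x} : Ideal (𝓞 K)) = Ideal.span {σ • x} := by
  rw [Ideal.pointwise_smul_def, Ideal.map_span, Set.image_singleton]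
  rfl

/-- The possible decomposition groups generated by `a`: trivial, containing `-1`, or of order three.
-/
theorem pow_three_units (a : (ZMod 9)ˣ) : a = 1 ∨ a ^ 3 = -1 ∨ a ≠ 1 ∧ a ^ 3 = 1 := by
  revert a
  decide

/-- An algebraic integer with the formal properties of a Jacobi sum attached to a prime `(π)` is
a conjugate of `cmNorm π`. -/
theorem exists_eq_gal_smul_cmNorm {ζ : K} (hζ : IsPrimitiveRoot ζ 9) {p : ℕ} [Fact p.Prime]
    (hp : p.Coprime 9) {P : Ideal (𝓞 K)} [P.IsMaximal] [P.LiesOver (Ideal.span {(p : ℤ)})]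
    {π β : 𝓞 K} (hπ : Ideal.span {π} = P) (hπ0 : π ≠ 0)
    (hπ1 : (hζ.toInteger - 1) ^ 4 ∣ π - 1) (hβ1 : (hζ.toInteger - 1) ^ 4 ∣ β - 1)
    (hmem1 : β ∈ P) (hmem2 : gal K u2 • β ∈ P) (hmem4 : gal K u4 • β ∈ P)
    (hβ : β * gal K (-1) • β = (Ideal.absNorm P : 𝓞 K))
    (hfrob : gal K (ZMod.unitOfCoprime p hp) • β = β) :
    ∃ u : (ZMod 9)ˣ, β = gal K u • cmNorm π := by
  have := nine_pid K
  set a := ZMod.unitOfCoprime p hp with ha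
  have hα : cmNorm π * gal K (-1) • cmNorm π = (Ideal.absNorm P : 𝓞 K) := by
    rw [cmNorm_mul_gal_neg_one_eq_absNorm, hπ]
  have hq0 : (Ideal.absNorm P : 𝓞 K) ≠ 0 := by
    rw [Nat.cast_ne_zero, Ne, Ideal.absNorm_eq_zero_iff, ← hπ, Ideal.span_singleton_eq_bot]
    exact hπ0
  have hprime : Prime π := by
    rw [← Ideal.span_singleton_prime hπ0, hπ]
    exact Ideal.IsMaximal.isPrime inferInstance
  have hpr : ∀ u, Prime (gal K u • π) := fun u =>
    (MulEquiv.prime_iff (MulSemiringAction.toRingEquiv Gal(K/ℚ) (𝓞 K) (gal K u)).toMulEquiv).2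
      hprime
  -- The decomposition group of `P` is generated by `p` modulo `9`.
  have hstab : ∀ u, gal K u • P = P ↔ u ∈ Subgroup.zpowers a := by
    intro u
    rw [← galEquivZMod_stabilizer 9 K p P hp]
    constructor
    · intro h
      exact ⟨gal K u, h, galEquivZMod_gal K u⟩
    · rintro ⟨σ, hσ, rfl⟩
      change gal K (galEquivZMod 9 K σ) • P = P
      rw [gal_galEquivZMod]
      exact hσ
  have hndvd : ∀ u v, u⁻¹ * v ∉ Subgroup.zpowers a → ¬ gal K u • π ∣ gal K v • π := by
    intro u v huv hdvd
    have hass := (hpr u).associated_of_dvd (hpr v) hdvd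
    rw [← Ideal.span_singleton_eq_span_singleton, ← smul_span_singleton, ← smul_span_singleton,
      hπ] at hass
    refine huv ((hstab _).1 ?_)
    rw [gal_mul, mul_smul, ← hass, gal_inv, inv_smul_smul]
  have hassoc : ∀ u v, u ∈ Subgroup.zpowers a → Associated (gal K (v * u) • π) (gal K v • π) := by
    intro u v hu
    rw [← Ideal.span_singleton_eq_span_singleton, ← smul_span_singleton, ← smul_span_singleton,
      hπ, gal_mul, mul_smul, (hstab u).2 hu]
  have hdvd : ∀ u, gal K u • β ∈ P → gal K u⁻¹ • π ∣ β := by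
    intro u hu
    rw [← hπ, Ideal.mem_span_singleton] at hu
    obtain ⟨c, hc⟩ := hu
    refine ⟨gal K u⁻¹ • c, ?_⟩
    rw [← smul_mul', ← hc, gal_inv, inv_smul_smul]
  -- The inverses of `1, 2, 4` modulo `9` are `1, 5, 7`: this is where the CM type comes from.
  have hd1 : gal K 1 • π ∣ β := hdvd 1 (by rwa [gal_one, one_smul])
  have hd5 : gal K u5 • π ∣ β := (show u2⁻¹ = u5 by decide) ▸ hdvd u2 hmem2
  have hd7 : gal K u7 • π ∣ β := (show u4⁻¹ = u7 by decide) ▸ hdvd u4 hmem4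
  -- The quotient `δ` satisfies `δ · σ₋₁(δ) = 1`, hence is a root of unity; it is `1` modulo `λ⁴`,
  -- hence equal to `1`.
  suffices h : ∃ u : (ZMod 9)ˣ, gal K u • cmNorm π ∣ β by
    obtain ⟨u, δ, hδ⟩ := h
    have hα' : gal K u • cmNorm π * gal K (-1) • gal K u • cmNorm π =
        (Ideal.absNorm P : 𝓞 K) := by
      rw [gal_smul_smul, mul_comm (-1) u, ← gal_smul_smul, ← smul_mul', hα]
      exact map_natCast (MulSemiringAction.toRingHom Gal(K/ℚ) (𝓞 K) (gal K u)) _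
    have hδ1 : δ * gal K (-1) • δ = 1 := by
      refine mul_left_cancel₀ hq0 ?_
      conv_rhs => rw [mul_one, ← hβ, hδ, smul_mul']
      rw [← hα']
      ring
    have hαu : (hζ.toInteger - 1) ^ 4 ∣ gal K u • cmNorm π - 1 := by
      have hx : ∀ v, (hζ.toInteger - 1) ^ 4 ∣ gal K v • π - 1 := fun v => by
        have := sub_one_pow_dvd_smul hζ (gal K v) hπ1
        rwa [smul_sub, smul_one] at this
      have hxy : ∀ x y : 𝓞 K, (hζ.toInteger - 1) ^ 4 ∣ x - 1 → (hζ.toInteger - 1) ^ 4 ∣ y - 1 →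
          (hζ.toInteger - 1) ^ 4 ∣ x * y - 1 := fun x y h h' => by
        have := dvd_add (h.mul_right y) h'
        convert this using 1
        ring
      rw [gal_smul_cmNorm, cmNorm, gal_smul_smul, gal_smul_smul]
      exact hxy _ _ (hxy _ _ (hx _) (hx _)) (hx _)
    have hδ4 : (hζ.toInteger - 1) ^ 4 ∣ δ - 1 := by
      have := dvd_sub hβ1 (hαu.mul_right δ)
      convert this using 1
      rw [hδ]
      ring
    have := eq_one_of_isOfFinOrder hζ (isOfFinOrder_of_mul_gal_eq_one hδ1) hδ4
    exact ⟨u, by rw [hδ, this, mul_one]⟩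
  have hα1 : gal K 1 • cmNorm π = gal K 1 • π * gal K u5 • π * gal K u7 • π := by
    simp only [gal_one, one_smul, cmNorm]
  rcases pow_three_units a with h1 | h3 | ⟨hne, h3⟩
  -- Split case: the three conjugates of `π` are pairwise non-associated primes, so their product
  -- divides `β`.
  · have hz : ∀ w : (ZMod 9)ˣ, w ≠ 1 → w ∉ Subgroup.zpowers a := by
      intro w hw hmem
      rw [h1, Subgroup.zpowers_one_eq_bot, Subgroup.mem_bot] at hmem
      exact hw hmem
    refine ⟨1, ?_⟩
    rw [hα1]
    obtain ⟨c, hc⟩ := hd1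
    rw [hc] at hd5 hd7 ⊢
    obtain ⟨d, rfl⟩ := ((hpr u5).dvd_or_dvd hd5).resolve_left (hndvd _ _ (hz _ (by decide)))
    have h7 := ((hpr u7).dvd_or_dvd hd7).resolve_left (hndvd _ _ (hz _ (by decide)))
    have h7' := ((hpr u7).dvd_or_dvd h7).resolve_left (hndvd _ _ (hz _ (by decide)))
    rw [mul_assoc]
    exact mul_dvd_mul_left _ (mul_dvd_mul_left _ h7')
  -- Here `σ₋₁` fixes both `β` and `P`, so with `α = cmNorm π` the number `β² = q = α · σ₋₁(α)` is
  -- associated to `α²`.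
  · have hneg : (-1 : (ZMod 9)ˣ) ∈ Subgroup.zpowers a := h3 ▸ Subgroup.npow_mem_zpowers a 3
    have hβc : gal K (-1) • β = β := by
      rw [← h3, pow_succ, pow_two, ← gal_smul_smul, ← gal_smul_smul, hfrob, hfrob, hfrob]
    have hαc : Associated (gal K (-1) • cmNorm π) (cmNorm π) := by
      have h1' := hassoc (-1) 1 hneg
      have h5 := hassoc (-1) u5 hneg
      have h7 := hassoc (-1) u7 hneg
      rw [gal_smul_cmNorm, cmNorm, cmNorm, gal_smul_smul, gal_smul_smul]
      rw [one_mul, gal_one, one_smul] at h1'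
      exact (h1'.mul_mul h5).mul_mul h7
    refine ⟨1, ?_⟩
    rw [gal_one, one_smul, ← UniqueFactorizationMonoid.pow_dvd_pow_iff_dvd two_ne_zero, pow_two β]
    nth_rw 2 [← hβc]
    rw [hβ, ← hα, pow_two]
    exact mul_dvd_mul_left _ hαc.symm.dvd
  -- Two primes lie above `p`, and divisibility only yields the factors `σ₁π` and `σ₅π` of `β`. The
  -- remaining factor `d` satisfies `d · σ₋₁(d) = σ₇π · σ₂π`: if `σ₇π ∣ d` then `cmNorm π` divides
  -- `β`, and if `σ₂π ∣ d` then its conjugate under `σ₂` does.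
  · have hz : ∀ w : (ZMod 9)ˣ, w ^ 3 ≠ 1 → w ∉ Subgroup.zpowers a := by
      rintro w hw ⟨i, rfl⟩
      refine hw ?_
      change (a ^ i) ^ 3 = 1
      rw [← zpow_natCast, zpow_comm, zpow_natCast, h3, one_zpow]
    obtain ⟨c, hc⟩ := hd1
    have hd5' := hd5
    rw [hc] at hd5'
    obtain ⟨d, rfl⟩ := ((hpr u5).dvd_or_dvd hd5').resolve_left (hndvd _ _ (hz _ (by decide)))
    have hcd : gal K u7 • π * gal K u2 • π = d * gal K (-1) • d := by
      have hβ' := hβ.trans hα.symm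
      rw [cmNorm_mul_gal_neg_one, univ_units_zmod_nine, Finset.prod_insert (by decide),
        Finset.prod_insert (by decide), Finset.prod_insert (by decide),
        Finset.prod_insert (by decide), Finset.prod_insert (by decide), Finset.prod_singleton, hc,
        smul_mul', smul_mul', gal_smul_smul, gal_smul_smul, mul_one,
        show -1 * u5 = u4 by decide] at hβ'
      refine mul_left_cancel₀ (mul_ne_zero (mul_ne_zero (hpr 1).ne_zero (hpr u5).ne_zero)
        (mul_ne_zero (hpr (-1)).ne_zero (hpr u4).ne_zero)) ?_
      linear_combination -hβ'
    rcases (hpr u7).dvd_or_dvd (Dvd.intro _ hcd) with h | ⟨e, he⟩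
    · refine ⟨1, ?_⟩
      rw [hα1, hc, mul_assoc]
      exact mul_dvd_mul_left _ (mul_dvd_mul_left _ h)
    · have hd2 : gal K u2 • π ∣ d := by
        refine ⟨gal K (-1) • e, ?_⟩
        have := congrArg (gal K (-1) • ·) he
        simp only [smul_mul', gal_smul_smul] at this
        rwa [show (-1 : (ZMod 9)ˣ) * -1 = 1 by decide, gal_one, one_smul,
          show -1 * u7 = u2 by decide] at this
      refine ⟨u2, ?_⟩
      rw [gal_smul_cmNorm, cmNorm, gal_smul_smul, gal_smul_smul, show u5 * u2 = 1 by decide,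
        show u7 * u2 = u5 by decide, hc]
      have : gal K u2 • π * gal K 1 • π * gal K u5 • π =
        gal K 1 • π * (gal K u5 • π * gal K u2 • π) := by ring
      rw [this]
      exact mul_dvd_mul_left _ (mul_dvd_mul_left _ hd2)

end GaloisAction

end PicardCM

namespace PicardCM

/-! ### Point counts in terms of Hecke character values -/

section ResidueCharacter

open NumberField IsCyclotomicExtension.Rat

variable {K : Type*} [Field K] [NumberField K] [IsCyclotomicExtension {9} ℚ K]

section MulChar

variable {k : Type*} [Field k] {χ : MulChar k (𝓞 K)} (hχ : orderOf χ = 9)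

include hχ

omit [NumberField K] [IsCyclotomicExtension {9} ℚ K] in
theorem mulChar_apply_pow_nine {x : k} (hx : x ≠ 0) : χ x ^ 9 = 1 := by
  rw [← MulChar.pow_apply' _ (by norm_num), ← hχ, pow_orderOf_eq_one,
    MulChar.one_apply (isUnit_iff_ne_zero.2 hx)]

theorem gal_smul_mulChar_apply {u : (ZMod 9)ˣ} {i : ℕ} (hi : i ≠ 0) (hiu : (i : ZMod 9) = u)
    (x : k) : gal K u • χ x = (χ ^ i) x := by
  rw [MulChar.pow_apply' _ hi]
  by_cases hx : x = 0
  · rw [hx, MulChar.map_zero, smul_zero, zero_pow hi]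
  · have h9 := mulChar_apply_pow_nine hχ hx
    rw [gal_smul_of_pow_eq_one u h9]
    have : u.val.val ≡ i [MOD 9] := by
      rw [← ZMod.natCast_eq_natCast_iff, ZMod.natCast_zmod_val, hiu]
    rw [← pow_mod_orderOf, ← pow_mod_orderOf _ i]
    exact congrArg _ (this.of_dvd (orderOf_dvd_of_pow_eq_one h9))

theorem gal_smul_jacobiSum [Fintype k] {u : (ZMod 9)ˣ} {i : ℕ} (hi : i ≠ 0)
    (hiu : (i : ZMod 9) = u) :
    gal K u • jacobiSum χ (χ ^ 3) = jacobiSum (χ ^ i) (χ ^ (3 * i)) := by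
  rw [jacobiSum, jacobiSum, Finset.smul_sum]
  refine Finset.sum_congr rfl fun x _ => ?_
  rw [smul_mul', MulChar.pow_apply' χ three_ne_zero, smul_pow',
    gal_smul_mulChar_apply hχ hi hiu, gal_smul_mulChar_apply hχ hi hiu, mul_comm 3 i, pow_mul,
    MulChar.pow_apply' _ three_ne_zero]

theorem sum_unitExponents [Fintype k] (m : ℕ) :
    ∑ i ∈ unitExponents, (-jacobiSum (χ ^ i) (χ ^ (3 * i))) ^ m =
      ∑ u : (ZMod 9)ˣ, (gal K u • (-jacobiSum χ (χ ^ 3))) ^ m := by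
  refine (Finset.sum_bij (fun u _ => u.val.val) ?_ ?_ ?_ ?_).symm
  · decide
  · decide
  · decide
  · intro u _
    rw [smul_neg, gal_smul_jacobiSum hχ (i := u.val.val) ?_ (ZMod.natCast_zmod_val _)]
    revert u
    decide

omit [NumberField K] [IsCyclotomicExtension {9} ℚ K] in
theorem mulChar_sub_one_dvd {ζ : K} (hζ : IsPrimitiveRoot ζ 9) {x : k} (hx : x ≠ 0) :
    hζ.toInteger - 1 ∣ χ x - 1 ∧ (hζ.toInteger - 1) ^ 3 ∣ (χ ^ 3) x - 1 := by
  obtain ⟨j, -, hj⟩ := hζ.toInteger_isPrimitiveRoot.eq_pow_of_pow_eq_one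
    (mulChar_apply_pow_nine hχ hx)
  rw [MulChar.pow_apply' _ three_ne_zero, ← hj]
  refine ⟨sub_one_dvd_pow_sub_one _ _, ?_⟩
  have h3 : (hζ.toInteger - 1) ^ 3 ∣ hζ.toInteger ^ 3 - 1 := by
    have := (pow_dvd_pow _ (by norm_num : 3 ≤ 4)).trans
      (dvd_cube_third_layer (toInteger_relation hζ))
    simpa using dvd_add this dvd_rfl
  rw [pow_right_comm]
  exact h3.trans (sub_one_dvd_pow_sub_one _ _)

-- The exponent four of the modulus is `1 + 3`: `χ(x) - 1` is divisible by `λ` and `χ³(1 - x) - 1`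
-- by `λ³`. Thus `-J ≡ q`, and `q ≡ 1` modulo `9`.
omit [NumberField K] [IsCyclotomicExtension {9} ℚ K] in
theorem pow_four_dvd_neg_jacobiSum_sub_one [Fintype k] (h9 : 9 ∣ Fintype.card k - 1) {ζ : K}
    (hζ : IsPrimitiveRoot ζ 9) :
    (hζ.toInteger - 1) ^ 4 ∣ -jacobiSum χ (χ ^ 3) - 1 := by
  have hχ1 : χ ≠ 1 := by
    rintro rfl
    rw [orderOf_one] at hχ
    norm_num at hχ
  have hχ3 : χ ^ 3 ≠ 1 := by
    intro h
    have := orderOf_dvd_of_pow_eq_one h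
    rw [hχ] at this
    norm_num at this
  have h1 := dvd_jacobiSum_add_card (d := (hζ.toInteger - 1) ^ 4) hχ1 hχ3 fun x hx0 hx1 => by
    rw [pow_succ']
    exact mul_dvd_mul (mulChar_sub_one_dvd hχ hζ hx0).1
      (mulChar_sub_one_dvd hχ hζ (sub_ne_zero.2 hx1.symm)).2
  have h2 : (hζ.toInteger - 1) ^ 4 ∣ (Fintype.card k : 𝓞 K) - 1 := by
    obtain ⟨c, hc⟩ := h9
    have hpos : 1 ≤ Fintype.card k := Fintype.card_pos
    have : ((Fintype.card k : ℕ) : 𝓞 K) = 3 * (3 * c) + 1 := by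
      rw [← Nat.sub_add_cancel hpos, hc]
      push_cast
      ring
    rw [this, add_sub_cancel_right]
    refine Dvd.dvd.mul_right ?_ _
    rw [three_eq_sub_one_pow_mul (toInteger_relation hζ)]
    exact (pow_dvd_pow _ (by norm_num)).mul_right _
  have := dvd_sub h2 h1
  convert this using 1
  ring

theorem jacobiSum_mul_gal_neg_one [Fintype k] (hk : (ringChar k) ≠ 0) :
    jacobiSum χ (χ ^ 3) * gal K (-1) • jacobiSum χ (χ ^ 3) = (Fintype.card k : 𝓞 K) := by
  have h9 : χ ^ 9 = 1 := hχ ▸ pow_orderOf_eq_one χ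
  have hne : ∀ i, ¬ 9 ∣ i → χ ^ i ≠ 1 := fun i hi h => hi (hχ ▸ orderOf_dvd_of_pow_eq_one h)
  have hinj : Function.Injective (algebraMap (𝓞 K) K) := RingOfIntegers.coe_injective
  have hinv : χ ^ 8 = χ⁻¹ := eq_inv_of_mul_eq_one_left (by rw [← pow_succ, h9])
  have hinv3 : χ ^ (3 * 8) = (χ ^ 3)⁻¹ := by rw [mul_comm, pow_mul, hinv, inv_pow]
  rw [gal_smul_jacobiSum hχ (i := 8) (by norm_num) (by decide), hinv, hinv3]
  refine hinj ?_
  rw [map_mul, ← jacobiSum_ringHomComp, ← jacobiSum_ringHomComp, map_natCast,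
    ← MulChar.ringHomComp_inv, ← MulChar.ringHomComp_inv]
  have hchar : ringChar K ≠ ringChar k := by
    rw [ringChar.eq_zero]
    exact hk.symm
  refine jacobiSum_mul_jacobiSum_inv hchar ?_ ?_ ?_
  · rw [MulChar.ringHomComp_ne_one_iff hinj]
    simpa using hne 1 (by norm_num)
  · rw [MulChar.ringHomComp_ne_one_iff hinj]
    exact hne 3 (by norm_num)
  · rw [← MulChar.ringHomComp_mul, MulChar.ringHomComp_ne_one_iff hinj, ← pow_succ']
    exact hne 4 (by norm_num)

end MulChar

/-! ### Jacobi sums over residue fields and the resulting point counts -/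

variable {p : ℕ} [Fact p.Prime]

theorem not_dvd_nine (hp : p.Coprime 9) : ¬ p ∣ 9 := fun h =>
  (Fact.out : p.Prime).one_lt.ne' (Nat.eq_one_of_dvd_coprimes hp dvd_rfl h)

theorem absNorm_eq_pow_orderOf (P : Ideal (𝓞 K)) [P.IsPrime]
    [P.LiesOver (Ideal.span {(p : ℤ)})] (hp : p.Coprime 9) :
    Ideal.absNorm P = p ^ orderOf (p : ZMod 9) := by
  rw [← Ideal.pow_inertiaDeg p P, inertiaDeg_eq_of_not_dvd (m := 9) p K P (not_dvd_nine hp)]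

attribute [local instance] Ideal.Quotient.field in
/-- The point counts over the extensions of the residue field of a prime `(π)`. -/
theorem natCast_pointCount_of_dvd (hp : p.Coprime 9) {ζ : K} (hζ : IsPrimitiveRoot ζ 9)
    {P : Ideal (𝓞 K)} [P.IsMaximal] [P.LiesOver (Ideal.span {(p : ℤ)})] {π : 𝓞 K} (hπ : Ideal.span {π} = P)
    (hπ0 : π ≠ 0) (hπ1 : (hζ.toInteger - 1) ^ 4 ∣ π - 1) {n : ℕ} (hn : n ≠ 0)
    (hdvd : orderOf (p : ZMod 9) ∣ n) :
    (pointCount (GaloisField p n) : 𝓞 K) =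
      (p : 𝓞 K) ^ n + 1 - ∑ u, (gal K u • cmNorm π) ^ (n / orderOf (p : ZMod 9)) := by
  have hpp : p.Prime := Fact.out
  have hN := absNorm_eq_pow_orderOf P hp
  have hPbot : P ≠ ⊥ := by
    rw [← hπ, Ne, Ideal.span_singleton_eq_bot]
    exact hπ0
  have : Finite (𝓞 K ⧸ P) := Ring.HasFiniteQuotients.finiteQuotient hPbot
  have := Fintype.ofFinite (𝓞 K ⧸ P)
  have hcard : Fintype.card (𝓞 K ⧸ P) = Ideal.absNorm P := by
    rw [Fintype.card_eq_nat_card]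
    rfl
  have hred : IsPrimitiveRoot (Ideal.Quotient.mk P hζ.toInteger) 9 := by
    refine hζ.toInteger_isPrimitiveRoot.idealQuotient_mk
      (by simpa using Ideal.IsMaximal.ne_top inferInstance) ?_
    rw [hN]
    exact Nat.Coprime.pow_left _ hp
  have hp0 : (p : 𝓞 K ⧸ P) = 0 := by
    have h := Nat.cast_card_eq_zero (𝓞 K ⧸ P)
    rw [hcard, hN, Nat.cast_pow] at h
    exact pow_eq_zero_iff (fun h0 => by
      rw [h0, pow_zero] at hN
      rw [hN] at hcard
      exact (Fintype.one_lt_card (α := 𝓞 K ⧸ P)).ne' hcard) |>.1 h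
  have hchar : CharP (𝓞 K ⧸ P) p := (CharP.charP_iff_prime_eq_zero hpp).2 hp0
  obtain ⟨h9, χ, hχ, hres⟩ := exists_residue_mulChar (Ideal.Quotient.mk P)
    hζ.toInteger_isPrimitiveRoot hred
  have hχ9 : χ ^ 9 = 1 := hχ ▸ pow_orderOf_eq_one χ
  -- Used for the pairs `(1, 3)`, `(2, 6)` and `(4, 12 ≡ 3)`, the conjugates under `σ₁, σ₂, σ₄`.
  have hmem : ∀ {a b : ℕ}, a ≠ 0 → b ≠ 0 → a + b < 9 → jacobiSum (χ ^ a) (χ ^ b) ∈ P :=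
    fun ha hb hab => Ideal.Quotient.eq_zero_iff_mem.1
      (map_jacobiSum_eq_zero (Ideal.Quotient.mk P) h9 hres ha hb hab)
  obtain ⟨v, hv⟩ := exists_eq_gal_smul_cmNorm hζ hp hπ hπ0 hπ1 (β := -jacobiSum χ (χ ^ 3))
    (pow_four_dvd_neg_jacobiSum_sub_one hχ h9 hζ)
    (P.neg_mem (by simpa using hmem (a := 1) (b := 3) (by norm_num) (by norm_num) (by norm_num)))
    (by
      rw [smul_neg, gal_smul_jacobiSum hχ (i := 2) (by norm_num) (by decide)]
      exact P.neg_mem (hmem (by norm_num) (by norm_num) (by norm_num)))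
    (by
      rw [smul_neg, gal_smul_jacobiSum hχ (i := 4) (by norm_num) (by decide),
        show 3 * 4 = 9 + 3 by norm_num, pow_add χ 9, hχ9, one_mul]
      exact P.neg_mem (hmem (by norm_num) (by norm_num) (by norm_num)))
    (by
      rw [smul_neg, neg_mul_neg, jacobiSum_mul_gal_neg_one hχ ?_, hcard]
      rw [ringChar.eq (𝓞 K ⧸ P) p]
      exact hpp.ne_zero)
    (by
      rw [smul_neg, gal_smul_jacobiSum hχ (i := p) hpp.ne_zero rfl, pow_mul,
        jacobiSum_pow_char p])
  rw [pointCount_eq, Nat.cast_add, Nat.cast_one,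
    natCast_card_affinePoint_galoisField p (hcard.trans hN) hn hdvd hχ, sum_unitExponents hχ, hv]
  have : ∑ u, (gal K u • gal K v • cmNorm π) ^ (n / orderOf (p : ZMod 9)) =
      ∑ u, (gal K u • cmNorm π) ^ (n / orderOf (p : ZMod 9)) := by
    simp only [gal_smul_smul]
    exact Equiv.sum_comp (Equiv.mulRight v)
      fun u => (gal K u • cmNorm π) ^ (n / orderOf (p : ZMod 9))
  rw [this]
  ring

theorem pointCount_of_not_dvd (p : ℕ) [Fact p.Prime] {n : ℕ} (hn : n ≠ 0)
    (hdvd : ¬ orderOf (p : ZMod 9) ∣ n) : pointCount (GaloisField p n) = p ^ n + 1 := by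
  classical
  have := Fintype.ofFinite (GaloisField p n)
  have hcard : Fintype.card (GaloisField p n) = p ^ n := by
    rw [Fintype.card_eq_nat_card, GaloisField.card p n hn]
  rw [pointCount_eq, card_affinePoint_of_not_nine_dvd, hcard]
  intro h
  rw [hcard] at h
  refine hdvd (orderOf_dvd_of_pow_eq_one ?_)
  have hpos : 1 ≤ p ^ n := Nat.one_le_pow _ _ (Fact.out : p.Prime).pos
  have := (ZMod.natCast_eq_natCast_iff _ _ _).2 ((Nat.modEq_iff_dvd' hpos).2 h)
  simpa using this.symm

end ResidueCharacter

end PicardCM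

namespace PicardCM

/-! ### The local factor as a polynomial in `T` -/

section LocalFactor

/-- The logarithm series in `a T^f`, re-indexed by `n = f m`; the factor `f` cancels against `n`,
and the term `n = 0` is zero since division by zero gives zero. -/
theorem hasSum_pow_mul_div {f : ℕ} (hf : f ≠ 0) {a T : ℂ} (h : ‖a * T ^ f‖ < 1) :
    HasSum (fun n : ℕ => if f ∣ n then f * a ^ (n / f) * T ^ n / n else 0)
      (-Complex.log (1 - a * T ^ f)) := by
  have hinj : Function.Injective (fun m : ℕ => f * m) := fun m n hmn =>
    Nat.eq_of_mul_eq_mul_left (Nat.pos_of_ne_zero hf) hmn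
  rw [← hinj.hasSum_iff fun n hn => if_neg fun ⟨m, hm⟩ => hn ⟨m, hm.symm⟩]
  refine (Complex.hasSum_taylorSeries_neg_log h).congr_fun fun m => ?_
  have hf' : (f : ℂ) ≠ 0 := Nat.cast_ne_zero.2 hf
  simp only [Function.comp_apply, dvd_mul_right, if_true,
    Nat.mul_div_cancel_left m (Nat.pos_of_ne_zero hf), mul_pow, ← pow_mul, Nat.cast_mul]
  rw [mul_assoc, mul_div_mul_left _ _ hf']

/-- The local factor is determined by the shape of the point counts. -/
theorem localFactor_eq_prod (p : ℕ) [Fact p.Prime] {f : ℕ} (hf : f ≠ 0) {T : ℂ}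
    (hT : ‖(p : ℂ) * T‖ < 1) {ι : Type*} [Fintype ι] (a : ι → ℂ) (ha : ∀ i, ‖a i * T ^ f‖ < 1)
    (h : ∀ n ≠ 0, (pointCount (GaloisField p n) : ℂ) =
      p ^ n + 1 - if f ∣ n then f * ∑ i, a i ^ (n / f) else 0) :
    localFactor p T = ∏ i, (1 - a i * T ^ f) := by
  have hp1 : (1 : ℝ) ≤ ‖(p : ℂ)‖ := by
    rw [Complex.norm_natCast]
    exact_mod_cast (Fact.out : p.Prime).one_lt.le
  have hT1 : ‖T‖ < 1 := by
    refine lt_of_le_of_lt ?_ hT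
    rw [norm_mul]
    exact le_mul_of_one_le_left (norm_nonneg _) hp1
  have hne : ∀ {z : ℂ}, ‖z‖ < 1 → 1 - z ≠ 0 := fun {z} hz h0 => by
    rw [← sub_eq_zero.1 h0, norm_one] at hz
    exact lt_irrefl _ hz
  have hsum := ((Complex.hasSum_taylorSeries_neg_log hT).add
    (Complex.hasSum_taylorSeries_neg_log hT1)).sub
      (hasSum_sum fun i (_ : i ∈ Finset.univ) => hasSum_pow_mul_div hf (ha i))
  rw [← hasSum_nat_add_iff' 1] at hsum
  have hzeta : zetaC p T = Complex.exp (-Complex.log (1 - p * T) + -Complex.log (1 - T) -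
      ∑ i, -Complex.log (1 - a i * T ^ f)) := by
    rw [zetaC]
    congr 1
    refine (tsum_congr fun k => ?_).trans (hsum.tsum_eq.trans (by simp))
    rw [h (k + 1) k.succ_ne_zero, Nat.cast_succ]
    split_ifs
    · simp only [Finset.mul_sum, Finset.sum_mul, sub_mul, sub_div, add_mul, add_div,
        Finset.sum_div, mul_pow, one_mul]
    · simp [add_mul, add_div, mul_pow]
  rw [localFactor, hzeta, Complex.exp_sub, Complex.exp_add, Complex.exp_neg, Complex.exp_neg,
    Complex.exp_log (hne hT), Complex.exp_log (hne hT1), Complex.exp_sum]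
  simp only [Complex.exp_neg, fun i => Complex.exp_log (hne (ha i)), Finset.prod_inv_distrib]
  have h1 := hne hT
  have h2 := hne hT1
  rw [div_inv_eq_mul, ← mul_assoc, mul_mul_mul_comm, mul_comm _ (1 - T)⁻¹, mul_mul_mul_comm,
    mul_inv_cancel₀ h2, mul_comm _ (1 - (p : ℂ) * T),
    mul_inv_cancel₀ h1, one_mul, one_mul]

end LocalFactor

end PicardCM

namespace PicardCM

/-! ### The primes above a prime of good reduction -/

section Primes

open NumberField IsCyclotomicExtension.Rat
open scoped Pointwise

variable {K : Type*} [Field K] [NumberField K] [IsCyclotomicExtension {9} ℚ K]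
variable {ζ : K} (hζ : IsPrimitiveRoot ζ 9)

omit [IsCyclotomicExtension {9} ℚ K] in
theorem dvd_modulus_iff_sub_one_mem (P : Ideal (𝓞 K)) [P.IsPrime] :
    P ∣ modulus hζ ↔ hζ.toInteger - 1 ∈ P := by
  rw [modulus_eq_span, Ideal.dvd_iff_le, Ideal.span_singleton_le_iff_mem]
  exact ⟨fun h => Ideal.IsPrime.mem_of_pow_mem ‹_› _ h, fun h => P.pow_mem_of_mem h _ (by norm_num)⟩

omit [IsCyclotomicExtension {9} ℚ K] in
theorem dvd_modulus_iff_three_mem (P : Ideal (𝓞 K)) [P.IsPrime] :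
    P ∣ modulus hζ ↔ (3 : 𝓞 K) ∈ P := by
  rw [dvd_modulus_iff_sub_one_mem]
  constructor
  · intro h
    rw [three_eq_sub_one_pow_mul (toInteger_relation hζ)]
    exact P.mul_mem_right _ (P.pow_mem_of_mem h _ (by norm_num))
  · intro h
    have h3 : (hζ.toInteger - 1) ^ 6 ∈ P := by
      -- `(X - 1)⁶` is congruent to the ninth cyclotomic polynomial modulo `3`.
      rw [show (hζ.toInteger - 1) ^ 6 = 3 * (-2 * hζ.toInteger + 5 * hζ.toInteger ^ 2 -
          7 * hζ.toInteger ^ 3 + 5 * hζ.toInteger ^ 4 - 2 * hζ.toInteger ^ 5) by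
        linear_combination toInteger_relation hζ]
      exact P.mul_mem_right _ h
    exact Ideal.IsPrime.mem_of_pow_mem ‹_› _ h3

omit [NumberField K] [IsCyclotomicExtension {9} ℚ K] in
theorem natCast_mem_iff_of_liesOver (P : Ideal (𝓞 K)) {p : ℕ} [P.LiesOver (Ideal.span {(p : ℤ)})]
    (n : ℕ) : (n : 𝓞 K) ∈ P ↔ p ∣ n := by
  have h := Ideal.mem_of_liesOver P (Ideal.span {(p : ℤ)}) (n : ℤ)
  rw [Ideal.mem_span_singleton, Int.natCast_dvd_natCast] at h
  rw [h]
  simp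

/-- The primes of `K` that do not divide the modulus. -/
abbrev GoodIdeal : Type _ := {P : HeightOneSpectrum (𝓞 K) // ¬ P.asIdeal ∣ modulus hζ}

variable {hζ}

omit [NumberField K] [IsCyclotomicExtension {9} ℚ K] in
theorem GoodIdeal.liesOver_iff (P : GoodIdeal hζ) (p : ℕ) :
    P.1.asIdeal.LiesOver (Ideal.span {(p : ℤ)}) ↔
      Ideal.absNorm (Ideal.under ℤ P.1.asIdeal) = p := by
  rw [Ideal.liesOver_iff]
  constructor
  · intro h
    rw [← h, Ideal.absNorm_span_singleton]
    simp
  · rintro rfl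
    exact Int.ideal_span_absNorm_eq_self _

/-- The residue characteristic of a prime not dividing the modulus. -/
noncomputable def GoodIdeal.residueChar (P : GoodIdeal hζ) : GoodPrime :=
  ⟨⟨Ideal.absNorm (Ideal.under ℤ P.1.asIdeal),
    haveI := P.1.isPrime
    haveI : NeZero P.1.asIdeal := ⟨P.1.ne_bot⟩
    Nat.absNorm_under_prime P.1.asIdeal⟩, fun h => P.2 <| by
      have := P.1.isPrime
      have := (P.liesOver_iff 3).2 h
      rw [dvd_modulus_iff_three_mem]
      exact_mod_cast (natCast_mem_iff_of_liesOver P.1.asIdeal (p := 3) 3).2 dvd_rfl⟩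

omit [IsCyclotomicExtension {9} ℚ K] in
theorem GoodIdeal.residueChar_eq_iff (P : GoodIdeal hζ) (p : GoodPrime) :
    P.residueChar = p ↔ P.1.asIdeal.LiesOver (Ideal.span {((p.1 : ℕ) : ℤ)}) := by
  rw [P.liesOver_iff]
  exact ⟨fun h => congrArg (fun q : GoodPrime => (q.1 : ℕ)) h,
    fun h => Subtype.ext (Subtype.ext h)⟩

theorem GoodPrime.coprime_nine (p : GoodPrime) : (p.1 : ℕ).Coprime 9 := by
  rw [show 9 = 3 ^ 2 from rfl]
  exact ((Nat.coprime_primes p.1.2 Nat.prime_three).2 p.2).pow_right 2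

omit [IsCyclotomicExtension {9} ℚ K] in
variable (hζ) in
theorem exists_residueChar_eq (p : GoodPrime) : ∃ P : GoodIdeal hζ, P.residueChar = p := by
  have : Fact ((p.1 : ℕ)).Prime := ⟨p.1.2⟩
  have hp0 : ((p.1 : ℕ) : ℤ) ≠ 0 := Nat.cast_ne_zero.2 p.1.2.ne_zero
  have : (Ideal.span {((p.1 : ℕ) : ℤ)}).IsMaximal := Int.ideal_span_isMaximal_of_prime _
  obtain ⟨P, hP, hPp⟩ := Ideal.exists_maximal_ideal_liesOver_of_isIntegral (S := 𝓞 K)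
    (Ideal.span {((p.1 : ℕ) : ℤ)})
  have hbot : P ≠ ⊥ := Ideal.ne_bot_of_liesOver_of_ne_bot (p := Ideal.span {((p.1 : ℕ) : ℤ)})
    (by simpa using hp0) P
  refine ⟨⟨⟨P, hP.isPrime, hbot⟩, ?_⟩, (GoodIdeal.residueChar_eq_iff _ p).2 hPp⟩
  have := hP.isPrime
  change ¬ P ∣ modulus hζ
  rw [dvd_modulus_iff_three_mem]
  intro h3
  have h := (natCast_mem_iff_of_liesOver P (p := (p.1 : ℕ)) 3).1 (by exact_mod_cast h3)
  exact p.2 ((Nat.prime_dvd_prime_iff_eq p.1.2 Nat.prime_three).1 h)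

/-- The Galois conjugate of a prime not dividing the modulus. -/
noncomputable def GoodIdeal.conj (u : (ZMod 9)ˣ) (P : GoodIdeal hζ) : GoodIdeal hζ :=
  haveI := P.1.isPrime
  ⟨⟨gal K u • P.1.asIdeal, inferInstance, fun h => P.1.ne_bot <| by
    rw [← inv_smul_smul (gal K u) P.1.asIdeal, h]
    exact Ideal.smul_bot _⟩, by
    rw [dvd_modulus_iff_three_mem, Ideal.mem_pointwise_smul_iff_inv_smul_mem]
    have h3 : (gal K u)⁻¹ • (3 : 𝓞 K) = 3 :=
      map_ofNat (MulSemiringAction.toRingHom Gal(K/ℚ) (𝓞 K) (gal K u)⁻¹) 3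
    rw [h3, ← dvd_modulus_iff_three_mem hζ]
    exact P.2⟩

theorem GoodIdeal.residueChar_conj (u : (ZMod 9)ˣ) (P : GoodIdeal hζ) :
    (P.conj u).residueChar = P.residueChar := by
  rw [residueChar_eq_iff]
  have := (P.residueChar_eq_iff _).1 rfl
  exact Ideal.LiesOver.smul _

theorem GoodIdeal.exists_conj_eq {P Q : GoodIdeal hζ} (h : P.residueChar = Q.residueChar) :
    ∃ u, P.conj u = Q := by
  have : IsGalois ℚ K := IsCyclotomicExtension.isGalois {9} ℚ K
  have := P.1.isPrime
  have := Q.1.isPrime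
  have := (P.residueChar_eq_iff _).1 h
  have := (Q.residueChar_eq_iff _).1 rfl
  obtain ⟨σ, hσ⟩ := Ideal.exists_smul_eq_of_isGaloisGroup
    (Ideal.span {((Q.residueChar.1 : ℕ) : ℤ)}) P.1.asIdeal Q.1.asIdeal Gal(K/ℚ)
  refine ⟨galEquivZMod 9 K σ, Subtype.ext (HeightOneSpectrum.ext ?_)⟩
  change gal K _ • P.1.asIdeal = _
  rw [gal_galEquivZMod, hσ]

-- The automorphisms carrying `P` to `Q` form a coset of the decomposition group, which is cyclic of
-- order equal to that of `p` modulo `9`.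
open Classical in
theorem GoodIdeal.card_conj_eq {P Q : GoodIdeal hζ} (h : P.residueChar = Q.residueChar) :
    (Finset.univ.filter fun u => P.conj u = Q).card =
      orderOf ((P.residueChar.1 : ℕ) : ZMod 9) := by
  have := P.1.isPrime
  have : Fact ((P.residueChar.1 : ℕ)).Prime := ⟨P.residueChar.1.2⟩
  have := (P.residueChar_eq_iff _).1 rfl
  have hp := P.residueChar.coprime_nine
  have hstab := galEquivZMod_stabilizer 9 K _ P.1.asIdeal hp
  obtain ⟨v, hv⟩ := P.exists_conj_eq h
  have hiff : ∀ u, P.conj u = Q ↔ v⁻¹ * u ∈ Subgroup.zpowers (ZMod.unitOfCoprime _ hp) := by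
    intro u
    rw [← hstab, ← hv]
    have h1 : P.conj u = P.conj v ↔ gal K u • P.1.asIdeal = gal K v • P.1.asIdeal := by
      rw [Subtype.ext_iff, HeightOneSpectrum.ext_iff]
      rfl
    have h2 : v⁻¹ * u ∈ (galEquivZMod 9 K).mapSubgroup
        (MulAction.stabilizer Gal(K/ℚ) P.1.asIdeal) ↔
        gal K (v⁻¹ * u) ∈ MulAction.stabilizer Gal(K/ℚ) P.1.asIdeal := by
      rw [MulEquiv.coe_mapSubgroup, Subgroup.mem_map_equiv]
      rfl
    rw [h1, h2, MulAction.mem_stabilizer_iff, gal_mul, gal_inv, mul_smul, inv_smul_eq_iff]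
  have hbij : (Finset.univ.filter fun u => P.conj u = Q).card =
      Nat.card (Subgroup.zpowers (ZMod.unitOfCoprime _ hp)) := by
    rw [Nat.card_eq_fintype_card, Fintype.card_subtype]
    refine Finset.card_equiv (Equiv.mulLeft v⁻¹) fun u => ?_
    simp [hiff u]
  rw [hbij, Nat.card_zpowers, ← orderOf_units, ZMod.coe_unitOfCoprime]

instance (p : GoodPrime) : Finite {P : GoodIdeal hζ // P.residueChar = p} := by
  obtain ⟨P, hP⟩ := exists_residueChar_eq hζ p
  exact Finite.of_surjective (fun u => ⟨P.conj u, (P.residueChar_conj u).trans hP⟩)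
    fun ⟨Q, hQ⟩ => (P.exists_conj_eq (hP.trans hQ.symm)).imp fun u hu => Subtype.ext hu

/-- A sum over the conjugates of `P` in terms of the sum over the primes above `p`. -/
theorem GoodIdeal.sum_conj {M : Type*} [AddCommMonoid M] (P : GoodIdeal hζ)
    [Fintype {Q : GoodIdeal hζ // Q.residueChar = P.residueChar}] (g : GoodIdeal hζ → M) :
    ∑ u, g (P.conj u) = orderOf ((P.residueChar.1 : ℕ) : ZMod 9) •
      ∑ Q : {Q : GoodIdeal hζ // Q.residueChar = P.residueChar}, g Q := by
  classical
  rw [← Finset.sum_fiberwise (s := Finset.univ)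
    (g := fun u => (⟨P.conj u, P.residueChar_conj u⟩ :
      {Q : GoodIdeal hζ // Q.residueChar = P.residueChar})), Finset.smul_sum]
  refine Finset.sum_congr rfl fun Q _ => ?_
  rw [← P.card_conj_eq Q.2.symm, ← Finset.sum_const]
  refine Finset.sum_congr (Finset.filter_congr fun u _ => Subtype.ext_iff) fun u hu => ?_
  rw [(Finset.mem_filter.1 hu).2]

theorem card_residueChar_le (p : GoodPrime)
    [Fintype {P : GoodIdeal hζ // P.residueChar = p}] :
    Fintype.card {P : GoodIdeal hζ // P.residueChar = p} ≤ 6 := by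
  obtain ⟨P, hP⟩ := exists_residueChar_eq hζ p
  refine (Fintype.card_le_of_surjective
    (fun u : (ZMod 9)ˣ => (⟨P.conj u, (P.residueChar_conj u).trans hP⟩ :
      {P : GoodIdeal hζ // P.residueChar = p}))
    fun ⟨Q, hQ⟩ => (P.exists_conj_eq (hP.trans hQ.symm)).imp fun u hu => Subtype.ext hu).trans ?_
  decide

end Primes

end PicardCM

namespace PicardCM

/-! ### Comparison of the Euler products -/

section Comparison

open NumberField IsCyclotomicExtension.Rat
open scoped Pointwise

variable {K : Type*} [Field K] [NumberField K] [IsCyclotomicExtension {9} ℚ K]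
variable {ζ : K} {hζ : IsPrimitiveRoot ζ 9}

/-- The primes not dividing the modulus have a generator congruent to `1`. -/
theorem GoodIdeal.exists_span_eq (P : GoodIdeal hζ) :
    ∃ π : 𝓞 K, Ideal.span {π} = P.1.asIdeal ∧ π ≠ 0 ∧ (hζ.toInteger - 1) ^ 4 ∣ π - 1 := by
  have := nine_pid K
  obtain ⟨x, hx⟩ := (IsPrincipalIdealRing.principal P.1.asIdeal).principal
  replace hx : P.1.asIdeal = Ideal.span {x} := hx
  have hx0 : x ≠ 0 := fun h => P.1.ne_bot (by rw [hx, h, Ideal.span_singleton_eq_bot])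
  have hprime : Prime x := by
    rw [← Ideal.span_singleton_prime hx0, ← hx]
    exact P.1.isPrime
  have hdvd : ¬ hζ.toInteger - 1 ∣ x := fun h => P.2 <| by
    have := P.1.isPrime
    rw [dvd_modulus_iff_sub_one_mem, hx, Ideal.mem_span_singleton]
    exact ((prime_toInteger_sub_one hζ).associated_of_dvd hprime h).symm.dvd
  obtain ⟨u, hu⟩ := exists_unit_congr_one hζ hdvd
  refine ⟨u * x, ?_, mul_ne_zero u.ne_zero hx0, hu⟩
  rw [hx, Ideal.span_singleton_mul_left_unit u.isUnit]

variable {ι : K →+* ℂ} {ψ : coprimeIdeals (modulus hζ) →* ℂˣ}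
  (hψ : IsGrossencharakter ι (typeΦ ζ) (modulus hζ) ψ)

-- A generator `π ≡ 1` modulo the modulus makes the value of `ψ` a consequence of the infinity type
-- alone.
include hψ in
theorem grossencharakter_apply (P : GoodIdeal hζ) {π : 𝓞 K} (hπ : Ideal.span {π} = P.1.asIdeal)
    (hπ0 : π ≠ 0) (hπ1 : (hζ.toInteger - 1) ^ 4 ∣ π - 1) :
    (ψ ⟨primeUnit P.1, primeUnit_mem _ P.1 P.2⟩ : ℂ) = ι (cmNorm π : 𝓞 K) := by
  have hπK : (π : K) ≠ 0 := RingOfIntegers.coe_ne_zero_iff.2 hπ0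
  rw [hψ (Units.mk0 (π : K) hπK) _ ⟨π, 1, ?_, ?_, ?_⟩ ?_, ← prod_typeΦ hζ, Units.val_mk0]
  · rw [Ideal.span_singleton_one, ← Ideal.one_eq_top]
    exact isCoprime_one_left
  · rwa [modulus_eq_span, Ideal.mem_span_singleton]
  · simp
  · refine Units.ext ?_
    rw [coe_toPrincipalIdeal]
    simp [primeUnit, ← hπ, FractionalIdeal.coeIdeal_span_singleton]

theorem norm_map_cmNorm_sq (π : 𝓞 K) :
    ‖ι (cmNorm π : 𝓞 K)‖ ^ 2 = Ideal.absNorm (Ideal.span {π}) := by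
  have h := map_mul_gal_neg_one ι (cmNorm π)
  rw [cmNorm_mul_gal_neg_one_eq_absNorm, map_natCast, map_natCast] at h
  exact_mod_cast h.symm

include hψ in
theorem norm_grossencharakter_sq (P : GoodIdeal hζ) :
    ‖(ψ ⟨primeUnit P.1, primeUnit_mem _ P.1 P.2⟩ : ℂ)‖ ^ 2 = Ideal.absNorm P.1.asIdeal := by
  obtain ⟨π, hπ, hπ0, hπ1⟩ := P.exists_span_eq
  rw [grossencharakter_apply hψ P hπ hπ0 hπ1, norm_map_cmNorm_sq, hπ]

theorem GoodIdeal.absNorm_eq (P : GoodIdeal hζ) :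
    Ideal.absNorm P.1.asIdeal =
      (P.residueChar.1 : ℕ) ^ orderOf ((P.residueChar.1 : ℕ) : ZMod 9) := by
  have := P.1.isPrime
  have : Fact ((P.residueChar.1 : ℕ)).Prime := ⟨P.residueChar.1.2⟩
  have := (P.residueChar_eq_iff _).1 rfl
  exact absNorm_eq_pow_orderOf P.1.asIdeal P.residueChar.coprime_nine

theorem GoodPrime.orderOf_ne_zero (p : GoodPrime) : orderOf ((p.1 : ℕ) : ZMod 9) ≠ 0 := by
  rw [← ZMod.coe_unitOfCoprime _ p.coprime_nine, orderOf_units]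
  exact (orderOf_pos _).ne'

-- `|ψ(P)| = N(P)^(1/2)` and `N(P) ≥ p`, while the exponent `1/2 - Re s` is negative.
include hψ in
theorem norm_grossencharakter_mul_cpow_le (P : GoodIdeal hζ) {s : ℂ} (hs : 3 / 2 < s.re) :
    ‖(ψ ⟨primeUnit P.1, primeUnit_mem _ P.1 P.2⟩ : ℂ) *
      ((Ideal.absNorm P.1.asIdeal : ℕ) : ℂ) ^ (-s)‖ ≤
        ((P.residueChar.1 : ℕ) : ℝ) ^ (1 / 2 - s.re) := by
  have hp : 0 < (P.residueChar.1 : ℕ) := P.residueChar.1.2.pos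
  have hN : (P.residueChar.1 : ℕ) ≤ Ideal.absNorm P.1.asIdeal := by
    rw [P.absNorm_eq]
    exact Nat.le_self_pow P.residueChar.orderOf_ne_zero _
  have hN0 : 0 < Ideal.absNorm P.1.asIdeal := hp.trans_le hN
  have hN' : (0 : ℝ) < Ideal.absNorm P.1.asIdeal := Nat.cast_pos.2 hN0
  have hnorm : ‖(ψ ⟨primeUnit P.1, primeUnit_mem _ P.1 P.2⟩ : ℂ)‖ =
      (Ideal.absNorm P.1.asIdeal : ℝ) ^ (1 / 2 : ℝ) := by
    rw [← norm_grossencharakter_sq hψ P, ← Real.sqrt_eq_rpow, Real.sqrt_sq (norm_nonneg _)]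
  rw [norm_mul, hnorm, Complex.norm_natCast_cpow_of_pos hN0, ← Real.rpow_add hN', Complex.neg_re,
    ← sub_eq_add_neg]
  exact Real.rpow_le_rpow_of_nonpos (Nat.cast_pos.2 hp) (Nat.cast_le.2 hN) (by linarith)

theorem GoodPrime.rpow_le_half (p : GoodPrime) {x : ℝ} (hx : 3 / 2 < x) :
    ((p.1 : ℕ) : ℝ) ^ (1 / 2 - x) ≤ 1 / 2 := by
  refine (Real.rpow_le_rpow_of_nonpos two_pos (by exact_mod_cast p.1.2.two_le)
    (by linarith)).trans ?_
  refine (Real.rpow_le_rpow_of_exponent_le one_le_two (by linarith : 1 / 2 - x ≤ -1)).trans ?_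
  rw [Real.rpow_neg_one, one_div]

include hψ in
theorem eulerFactorC_eq_prod {s : ℂ} (hs : 3 / 2 < s.re) (p : GoodPrime)
    [Fintype {P : GoodIdeal hζ // P.residueChar = p}] :
    eulerFactorC s p =
      ∏ P : {P : GoodIdeal hζ // P.residueChar = p}, eulerFactorPsi (modulus hζ) ψ s P := by
  have : Fact ((p.1 : ℕ)).Prime := ⟨p.1.2⟩
  have hp0 : 0 < (p.1 : ℕ) := p.1.2.pos
  set f := orderOf ((p.1 : ℕ) : ZMod 9) with hf
  have hcpow : ∀ P : {P : GoodIdeal hζ // P.residueChar = p},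
      ((Ideal.absNorm P.1.1.asIdeal : ℕ) : ℂ) ^ (-s) = (((p.1 : ℕ) : ℂ) ^ (-s)) ^ f := by
    intro P
    rw [P.1.absNorm_eq, P.2, ← hf, Nat.cast_pow, ← Complex.natCast_cpow_natCast_mul,
      Complex.cpow_nat_mul]
  have hT : ‖((p.1 : ℕ) : ℂ) * ((p.1 : ℕ) : ℂ) ^ (-s)‖ < 1 := by
    rw [norm_mul, Complex.norm_natCast, Complex.norm_natCast_cpow_of_pos hp0,
      ← Real.rpow_one_add' (Nat.cast_nonneg _) (by rw [Complex.neg_re]; linarith)]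
    refine Real.rpow_lt_one_of_one_lt_of_neg (by exact_mod_cast p.1.2.one_lt) ?_
    rw [Complex.neg_re]
    linarith
  rw [eulerFactorC, localFactor_eq_prod (f := f) _ p.orderOf_ne_zero hT
    (fun P : {P : GoodIdeal hζ // P.residueChar = p} =>
      (ψ ⟨primeUnit P.1.1, primeUnit_mem _ P.1.1 P.1.2⟩ : ℂ)), ← Finset.prod_inv_distrib]
  · refine Finset.prod_congr rfl fun P _ => ?_
    rw [eulerFactorPsi, hcpow]
  · intro P
    rw [← hcpow P]
    refine (norm_grossencharakter_mul_cpow_le hψ P.1 hs).trans_lt ?_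
    exact (GoodPrime.rpow_le_half _ hs).trans_lt (by norm_num)
  · intro n hn
    split_ifs with hdvd
    · obtain ⟨P, rfl⟩ := exists_residueChar_eq hζ p
      obtain ⟨π, hπ, hπ0, hπ1⟩ := P.exists_span_eq
      have := P.1.isMaximal
      have := (P.residueChar_eq_iff _).1 rfl
      have hconj : ∀ u, (ψ ⟨primeUnit (P.conj u).1, primeUnit_mem _ _ (P.conj u).2⟩ : ℂ) =
          ι (algebraMap (𝓞 K) K (gal K u • cmNorm π)) := by
        intro u
        rw [gal_smul_cmNorm]
        refine grossencharakter_apply hψ (P.conj u) ?_ ?_ ?_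
        · rw [← smul_span_singleton, hπ]
          rfl
        · rwa [smul_ne_zero_iff_ne]
        · have := sub_one_pow_dvd_smul hζ (gal K u) hπ1
          rwa [smul_sub, smul_one] at this
      have h := congrArg (fun x => ι (algebraMap (𝓞 K) K x))
        (natCast_pointCount_of_dvd P.residueChar.coprime_nine hζ hπ hπ0 hπ1 hn hdvd)
      simp only [map_natCast, map_sub, map_add, map_pow, map_one, map_sum, ← hconj] at h
      -- Passing from conjugates of `P` to primes above `p` produces the factor `f` that
      -- `localFactor_eq_prod` expects.
      rw [h, P.sum_conj fun Q => (ψ ⟨primeUnit Q.1, primeUnit_mem _ Q.1 Q.2⟩ : ℂ) ^ (n / f),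
        nsmul_eq_mul]
    · rw [pointCount_of_not_dvd _ hn hdvd]
      push_cast
      ring

theorem norm_inv_one_sub_sub_one_le {z : ℂ} (hz : ‖z‖ ≤ 1 / 2) : ‖(1 - z)⁻¹ - 1‖ ≤ 2 * ‖z‖ := by
  have h1 : 1 / 2 ≤ ‖1 - z‖ := by
    have := norm_sub_norm_le (1 : ℂ) z
    rw [norm_one] at this
    linarith
  have hne : 1 - z ≠ 0 := norm_pos_iff.1 (by linarith)
  rw [show (1 - z)⁻¹ - 1 = z / (1 - z) by field_simp; ring, norm_div,
    div_le_iff₀ (by linarith)]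
  nlinarith [norm_nonneg z]

include hψ in
theorem norm_eulerFactorPsi_sub_one_le (P : GoodIdeal hζ) {s : ℂ} (hs : 3 / 2 < s.re) :
    ‖eulerFactorPsi (modulus hζ) ψ s P - 1‖ ≤
      2 * ((P.residueChar.1 : ℕ) : ℝ) ^ (1 / 2 - s.re) := by
  have h := norm_grossencharakter_mul_cpow_le hψ P hs
  exact (norm_inv_one_sub_sub_one_le (h.trans (GoodPrime.rpow_le_half _ hs))).trans
    (mul_le_mul_of_nonneg_left h two_pos.le)

include hψ in
theorem summable_eulerFactorPsi {s : ℂ} (hs : 3 / 2 < s.re) :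
    Summable fun P => ‖eulerFactorPsi (modulus hζ) ψ s P - 1‖ := by
  have hrpow : Summable fun p : GoodPrime => ((p.1 : ℕ) : ℝ) ^ (1 / 2 - s.re) :=
    (Nat.Primes.summable_rpow.2 (by linarith)).subtype {p : Nat.Primes | (p : ℕ) ≠ 3}
  rw [← (Equiv.sigmaFiberEquiv (GoodIdeal.residueChar (hζ := hζ))).summable_iff,
    summable_sigma_of_nonneg (fun _ => by exact norm_nonneg _)]
  have (p : GoodPrime) := Fintype.ofFinite {P : GoodIdeal hζ // P.residueChar = p}
  refine ⟨fun p => (hasSum_fintype _ (L := .unconditional _)).summable, ?_⟩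
  -- The constant is `12 = 6 · 2`: at most six primes above `p`, each within `2 p^(1/2 - Re s)`.
  refine Summable.of_nonneg_of_le (fun p => tsum_nonneg fun _ => norm_nonneg _) (fun p => ?_)
    (hrpow.mul_left 12)
  rw [tsum_fintype]
  refine (Finset.sum_le_card_nsmul Finset.univ _ (2 * ((p.1 : ℕ) : ℝ) ^ (1 / 2 - s.re))
    fun P _ => ?_).trans ?_
  · have h := norm_eulerFactorPsi_sub_one_le hψ P.1 hs
    rwa [P.2] at h
  · have h6 : (Fintype.card {P : GoodIdeal hζ // P.residueChar = p} : ℝ) ≤ 6 := by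
      exact_mod_cast card_residueChar_le p
    rw [Finset.card_univ, nsmul_eq_mul]
    nlinarith [Real.rpow_nonneg (Nat.cast_nonneg (α := ℝ) (p.1 : ℕ)) (1 / 2 - s.re)]

/-- Absolute convergence of a product is inherited by grouping the factors into finite products. -/
theorem summable_norm_prod_sub_one {α β : Type*} (r : α → β) [∀ b, Fintype {a // r a = b}]
    {g : α → ℂ} (hg : Summable fun a => ‖g a - 1‖) :
    Summable fun b => ‖∏ a : {a // r a = b}, g a - 1‖ := by
  have hsig := ((Equiv.sigmaFiberEquiv r).summable_iff).2 hg
  have ht : Summable fun b => ∑ a : {a // r a = b}, ‖g a - 1‖ := by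
    simpa [tsum_fintype] using hsig.sigma
  have hexp : ∀ x : ℝ, Real.exp x - 1 ≤ x * Real.exp x := fun x => by
    have h := mul_le_mul_of_nonneg_right (Real.add_one_le_exp (-x)) (Real.exp_pos x).le
    rw [← Real.exp_add, neg_add_cancel, Real.exp_zero] at h
    linarith
  refine Summable.of_nonneg_of_le (fun b => norm_nonneg _) (fun b => ?_)
    (ht.mul_right (Real.exp (∑' b, ∑ a : {a // r a = b}, ‖g a - 1‖)))
  have h0 : ∀ b, 0 ≤ ∑ a : {a // r a = b}, ‖g a - 1‖ := fun b =>
    Finset.sum_nonneg fun _ _ => norm_nonneg _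
  have h1 := Finset.norm_prod_one_add_sub_one_le Finset.univ
    fun a : {a // r a = b} => g a - 1
  simp only [add_sub_cancel] at h1
  refine (h1.trans (hexp _)).trans (mul_le_mul_of_nonneg_left ?_ (h0 b))
  exact Real.exp_le_exp.2 (ht.le_tsum b fun b' _ => h0 b')

theorem tprod_eq_tprod_prod {α β : Type*} (r : α → β) [∀ b, Fintype {a // r a = b}]
    {g : α → ℂ} (hg : Summable fun a => ‖g a - 1‖) :
    ∏' a, g a = ∏' b, ∏ a : {a // r a = b}, g a := by
  have hm : Multipliable g := by
    have h := Complex.multipliable_one_add_of_summable hg.of_norm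
    simpa using h
  rw [← (Equiv.sigmaFiberEquiv r).tprod_eq g]
  refine (Multipliable.tprod_sigma'
    (fun b => (hasProd_fintype _ (L := .unconditional _)).multipliable)
    ((Equiv.sigmaFiberEquiv r).multipliable_iff.2 hm)).trans ?_
  exact tprod_congr fun b => tprod_fintype _

end Comparison

end PicardCM
/-- Let `K = ℚ(ζ)` with `ζ` a primitive ninth root of unity, embedded in `ℂ` by `ι`, and let `ψ` be
the Grössencharakter of `K` of conductor `(1 + ζ + ζ⁴)⁴` and infinity type `{σ₁, σ₅, σ₇}`. On the
half plane `Re s > 3/2` the Euler products of `L(C, s)` and `L(ψ, s)` converge absolutely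
(a product `∏ f` being absolutely convergent when `∑ |f - 1| < ∞`), and `L(C, s) = L(ψ, s)`. -/
theorem proposition1p1 {K : Type*} [Field K] [NumberField K] [IsCyclotomicExtension {9} ℚ K]
    (ζ : K) (hζ : IsPrimitiveRoot ζ 9) (ι : K →+* ℂ)
    (ψ : PicardCM.coprimeIdeals (PicardCM.modulus hζ) →* ℂˣ)
    (hψ : PicardCM.IsGrossencharakterOfConductor ι (PicardCM.typeΦ ζ) (PicardCM.modulus hζ) ψ)
    (s : ℂ) (hs : 3 / 2 < s.re) :
    Summable (fun p => ‖PicardCM.eulerFactorC s p - 1‖) ∧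
      Summable (fun P => ‖PicardCM.eulerFactorPsi (PicardCM.modulus hζ) ψ s P - 1‖) ∧
      PicardCM.LC s = PicardCM.LPsi (PicardCM.modulus hζ) ψ s := by
  have h := PicardCM.summable_eulerFactorPsi hψ.1 hs
  have (p : PicardCM.GoodPrime) := Fintype.ofFinite
    {P : PicardCM.GoodIdeal hζ // P.residueChar = p}
  have hC := fun p => PicardCM.eulerFactorC_eq_prod hψ.1 hs p
  refine ⟨?_, h, ?_⟩
  · simp only [hC]
    exact PicardCM.summable_norm_prod_sub_one _ h
  · rw [PicardCM.LC, PicardCM.LPsi, PicardCM.tprod_eq_tprod_prod PicardCM.GoodIdeal.residueChar h]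
    exact tprod_congr hC
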